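/- Let $n>1$ be an integer and let $b\mathbb B^n=\{z\in\mathbb C^n:|z|=1\}$ be the unit sphere in $\mathbb C^n$, with real tangent spaces $T_p\,b\mathbb B^n$ and complex tangent hyperplanes $\xi_p=T_p\,b\mathbb B^n\cap i\,T_p\,b\mathbb B^n$. A smooth curve $f\colon\mathbb R\to b\mathbb B^n$ is called complex tangential if $\dot f(t)\in\xi_{f(t)}$ for every $t\in\mathbb R$. The cluster set of $f(\mathbb R_+)$ (respectively of $f(\mathbb R_-)$) is the set of all points $p\in b\mathbb B^n$ such that $p=\lim_{k\to\infty}f(t_k)$ for some sequence of real numbers $t_k\to+\infty$ (respectively $t_k\to-\infty$). For every nonempty open connected subset $\omega$ of $b\mathbb B^n$ there exists a real-analytic injective complex tangential immersion $f\colon\mathbb R\to b\mathbb B^n$ with $f(\mathbb R)\subset\omega$ such that the cluster set of $f(\mathbb R_+)$ and the cluster set of $f(\mathbb R_-)$ are both equal to $\overline\omega$. In particular (taking $\omega=b\mathbb B^n$), there exists a real-analytic injective complex tangential immersion $f\colon\mathbb R\to b\mathbb B^n$ with image dense in $b\mathbb B^n$ such that both of these cluster sets are equal to $b\mathbb B^n$.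 -/

import Mathlib

open Filter Topology

/-- Complex Euclidean space `ℂⁿ` with its standard Hermitian inner product and norm. -/
abbrev CSpace (n : ℕ) : Type := EuclideanSpace ℂ (Fin n)

/-- The unit sphere of `ℂⁿ`, that is, the boundary of the open unit ball. -/
abbrev CSphere (n : ℕ) : Type := Metric.sphere (0 : CSpace n) 1

/-- The real tangent space at `p` of the unit sphere of `ℂⁿ`: the vectors that are orthogonal to `p`
for the real Euclidean inner product `Re ⟪p, v⟫` of `ℂⁿ = ℝ²ⁿ`. -/
noncomputable def sphereTangentSpace {n : ℕ} (p : CSphere n) : Submodule ℝ (CSpace n) where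
  carrier := {v | (inner ℂ (p : CSpace n) v).re = 0}
  zero_mem' := by simp
  add_mem' := by
    intro v w hv hw
    simp only [Set.mem_ofPred_eq] at hv hw ⊢
    rw [inner_add_right, Complex.add_re, hv, hw, add_zero]
  smul_mem' := by
    intro c v hv
    simp only [Set.mem_ofPred_eq] at hv ⊢
    rw [← Complex.coe_smul, inner_smul_right, Complex.re_ofReal_mul, hv, mul_zero]

/-- The complex tangent hyperplane at `p`: the maximal complex subspace `T ∩ iT` of the real tangent
space `T` of the sphere at `p`. -/
noncomputable def complexTangentSpace {n : ℕ} (p : CSphere n) : Submodule ℂ (CSpace n) where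
  carrier := {v | v ∈ sphereTangentSpace p ∧ Complex.I • v ∈ sphereTangentSpace p}
  zero_mem' := by simp
  add_mem' := by
    rintro v w ⟨hv, hv'⟩ ⟨hw, hw'⟩
    refine ⟨add_mem hv hw, ?_⟩
    rw [smul_add]
    exact add_mem hv' hw'
  smul_mem' := by
    rintro c v ⟨hv, hv'⟩
    change (inner ℂ (p : CSpace n) v).re = 0 at hv
    change (inner ℂ (p : CSpace n) (Complex.I • v)).re = 0 at hv'
    have h0 : inner ℂ (p : CSpace n) v = 0 := by
      rw [inner_smul_right, Complex.I_mul_re, neg_eq_zero] at hv'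
      exact Complex.ext hv hv'
    constructor
    · change (inner ℂ (p : CSpace n) (c • v)).re = 0
      rw [inner_smul_right, h0, mul_zero, Complex.zero_re]
    · change (inner ℂ (p : CSpace n) (Complex.I • c • v)).re = 0
      rw [inner_smul_right, inner_smul_right, h0, mul_zero, mul_zero, Complex.zero_re]

/-- The complex tangent hyperplane at `p` is the Hermitian orthogonal complement of `p`. -/
theorem mem_complexTangentSpace_iff {n : ℕ} (p : CSphere n) (v : CSpace n) :
    v ∈ complexTangentSpace p ↔ inner ℂ (p : CSpace n) v = 0 := by
  change (inner ℂ (p : CSpace n) v).re = 0 ∧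
    (inner ℂ (p : CSpace n) (Complex.I • v)).re = 0 ↔ _
  rw [inner_smul_right, Complex.I_mul_re, neg_eq_zero, Complex.ext_iff, Complex.zero_re,
    Complex.zero_im]

/-- The velocity vector in `ℂⁿ`, at time `t`, of a curve in the sphere. -/
noncomputable def velocity {n : ℕ} (f : ℝ → CSphere n) (t : ℝ) : CSpace n :=
  deriv (fun s : ℝ => (f s : CSpace n)) t

/-- `f : ℝ → bBⁿ` is an injective real-analytic complex tangential immersion. The sphere is a closed
real-analytic submanifold of `ℂⁿ`, so analyticity and the differential of `f` are those of `f` as a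
curve in `ℂⁿ`. -/
structure IsInjectiveLegendrianCurve {n : ℕ} (f : ℝ → CSphere n) : Prop where
  /-- real-analytic on the whole line -/
  analytic : AnalyticOnNhd ℝ (fun t : ℝ => (f t : CSpace n)) Set.univ
  injective : Function.Injective f
  /-- an immersion: the velocity never vanishes -/
  immersion : ∀ t : ℝ, velocity f t ≠ 0
  /-- the velocity lies in the contact distribution of complex tangent hyperplanes -/
  complexTangential : ∀ t : ℝ, velocity f t ∈ complexTangentSpace (f t)

/-- The cluster set of `f` along a filter `l` on the line. For `l = atTop` it is the cluster set of
the half-curve `f(ℝ₊)`, the set of all limits of sequences `f (tₖ)` with `tₖ → +∞`; for `l = atBot`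
it is that of `f(ℝ₋)`. -/
def clusterSet {n : ℕ} (l : Filter ℝ) (f : ℝ → CSphere n) : Set (CSphere n) :=
  {p | MapClusterPt p l f}

/-! Fix `q` on the sphere and let `W` be the Hermitian orthogonal complement of `q`. The Cayley
transform identifies the sphere minus `q` with the Heisenberg group `W × ℝ` and sends horizontal
curves, those with `u' = Im ⟪w, w'⟫`, to complex tangential ones. A horizontal curve is determined
by its starting point and its control `v = w'`, which is arbitrary. An entire control gives a
real-analytic curve, so the problem becomes one of building a single entire function `V : ℂ → W`.

`V` is a limit of entire controls, each following its predecessor on a long interval `[-R, R]` and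
then coming close to a prescribed point at both ends. One step (`exists_entire_extension`) rests on
four facts. Any two points of an open connected set are joined by a horizontal polygon inside it
(`IsPreconnected.reflTransGen_horizontalStep`). The curve depends continuously on the control in
`L¹` (`exists_dist_horizontalCurve_le`), so the jumps of a concatenated control do no harm. A
correction vanishing on `(-R, R)` is `L¹`-close to an entire function that is small on the disc of
radius `R / 2` (`IsControl.exists_entire_approx`); this makes the controls converge locally
uniformly on `ℂ`. Finally a generic perturbation by a cubic polynomial makes the curve an injective
immersion (`exists_perturbedControl_injective`).

Injectivity is not closed under limits, so every stage records a margin `η` by which its properties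
on `[-R, R]` hold, and all later changes add up to at most `η` (`IsRobustControl`,
`dist_le_sub_of_succ`). Visiting the points of a dense sequence infinitely often gives the cluster
sets (`exists_entireCurve_clusterPt`). On the sphere, the point `q` missed by the chart is recovered
because cluster sets are closed. -/

open MeasureTheory Set
open scoped Interval

/-! ### Horizontal curves in the Heisenberg group and their stability -/

section HorizontalCurve

variable {W : Type*} [NormedAddCommGroup W] [InnerProductSpace ℂ W]

/-- The first component of the horizontal curve in the Heisenberg group `W × ℝ` starting at `P` with
control `v`. -/
noncomputable def horizontalPos (P : W × ℝ) (v : ℝ → W) (t : ℝ) : W := P.1 + ∫ s in 0..t, v s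

/-- The height of the horizontal curve in the Heisenberg group `W × ℝ` starting at `P` with
control `v`. -/
noncomputable def horizontalHeight (P : W × ℝ) (v : ℝ → W) (t : ℝ) : ℝ :=
  P.2 + ∫ s in 0..t, (inner ℂ (horizontalPos P v s) (v s)).im

/-- The horizontal curve in the Heisenberg group `W × ℝ` starting at `P` with control `v`, that is,
the curve `(w, u)` with `w' = v` and `u' = Im ⟪w, w'⟫`. -/
noncomputable def horizontalCurve (P : W × ℝ) (v : ℝ → W) (t : ℝ) : W × ℝ :=
  (horizontalPos P v t, horizontalHeight P v t)

/-- Integrability on all bounded intervals. -/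
def IntervalIntegrableOnLine (v : ℝ → W) : Prop := ∀ a b : ℝ, IntervalIntegrable v volume a b

variable {P : W × ℝ} {v v' : ℝ → W}

theorem continuous_horizontalPos (hv : IntervalIntegrableOnLine v) :
    Continuous (horizontalPos P v) :=
  continuous_const.add (intervalIntegral.continuous_primitive hv 0)

theorem intervalIntegrable_im_inner {p : ℝ → W} (hp : Continuous p)
    (hv : IntervalIntegrableOnLine v) (a b : ℝ) :
    IntervalIntegrable (fun s => (inner ℂ (p s) (v s)).im) volume a b := by
  have h1 : IntervalIntegrable (fun s => ‖p s‖ * ‖v s‖) volume a b := by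
    have := (hv a b).norm.mul_continuousOn (hp.norm.continuousOn (s := uIcc a b))
    simpa [mul_comm] using this
  refine h1.mono_fun ?_ ?_
  · exact Complex.continuous_im.comp_aestronglyMeasurable
      ((hp.aestronglyMeasurable.inner ((hv a b).def'.aestronglyMeasurable)))
  · filter_upwards with s
    rw [Real.norm_eq_abs, Real.norm_of_nonneg (by positivity)]
    exact (Complex.abs_im_le_norm _).trans (norm_inner_le_norm _ _)

theorem continuous_horizontalHeight (hv : IntervalIntegrableOnLine v) :
    Continuous (horizontalHeight P v) :=
  continuous_const.add (intervalIntegral.continuous_primitive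
    (intervalIntegrable_im_inner (continuous_horizontalPos hv) hv) 0)

theorem continuous_horizontalCurve (hv : IntervalIntegrableOnLine v) :
    Continuous (horizontalCurve P v) :=
  (continuous_horizontalPos hv).prodMk (continuous_horizontalHeight hv)

theorem uIoc_zero_subset {s t : ℝ} (hs : s ∈ Ι 0 t) : Ι 0 s ⊆ Ι 0 t := by
  rcases le_total 0 t with h | h
  · rw [uIoc_of_le h] at *
    rw [uIoc_of_le hs.1.le]
    exact Ioc_subset_Ioc_right hs.2
  · rw [uIoc_of_ge h] at *
    rw [uIoc_of_ge hs.2]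
    exact Ioc_subset_Ioc_left hs.1.le

theorem horizontalPos_congr {t : ℝ} (h : ∀ᵐ s, s ∈ Ι 0 t → v s = v' s) :
    horizontalPos P v t = horizontalPos P v' t := by
  rw [horizontalPos, horizontalPos, intervalIntegral.integral_congr_ae h]

theorem horizontalCurve_congr {t : ℝ} (h : ∀ᵐ s, s ∈ Ι 0 t → v s = v' s) :
    horizontalCurve P v t = horizontalCurve P v' t := by
  refine Prod.ext (horizontalPos_congr h) ?_
  change P.2 + _ = P.2 + _
  congr 1
  refine intervalIntegral.integral_congr_ae ?_
  filter_upwards [h] with s hs hst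
  have : horizontalPos P v s = horizontalPos P v' s := by
    refine horizontalPos_congr ?_
    filter_upwards [h] with x hx hxs using hx (uIoc_zero_subset hst hxs)
  rw [this, hs hst]

theorem horizontalPos_add (hv : IntervalIntegrableOnLine v) (r t : ℝ) :
    horizontalPos P v (r + t) = horizontalPos (horizontalCurve P v r) (fun s => v (r + s)) t := by
  have h := intervalIntegral.integral_comp_add_left (a := 0) (b := t) v r
  simp only [horizontalPos, horizontalCurve]
  rw [h, add_zero, add_assoc, intervalIntegral.integral_add_adjacent_intervals (hv _ _) (hv _ _)]

theorem horizontalCurve_add (hv : IntervalIntegrableOnLine v) (r t : ℝ) :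
    horizontalCurve P v (r + t) =
      horizontalCurve (horizontalCurve P v r) (fun s => v (r + s)) t := by
  refine Prod.ext (horizontalPos_add hv r t) ?_
  have h := intervalIntegral.integral_comp_add_left (a := 0) (b := t)
    (fun s => (inner ℂ (horizontalPos P v s) (v s)).im) r
  have hi := intervalIntegrable_im_inner (continuous_horizontalPos (P := P) hv) hv
  change P.2 + _ = (P.2 + _) + ∫ s in 0..t, (inner ℂ _ _).im
  simp_rw [← horizontalPos_add hv r]
  rw [h, add_zero, add_assoc, intervalIntegral.integral_add_adjacent_intervals (hi _ _) (hi _ _)]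

theorem horizontalPos_neg (t : ℝ) :
    horizontalPos P v (-t) = horizontalPos P (fun s => -v (-s)) t := by
  have h := intervalIntegral.integral_comp_neg (a := 0) (b := t) v
  simp only [horizontalPos, intervalIntegral.integral_neg]
  rw [h, neg_zero, intervalIntegral.integral_symm]

theorem horizontalCurve_neg (t : ℝ) :
    horizontalCurve P v (-t) = horizontalCurve P (fun s => -v (-s)) t := by
  refine Prod.ext (horizontalPos_neg t) ?_
  have h := intervalIntegral.integral_comp_neg (a := 0) (b := t)
    (fun s => (inner ℂ (horizontalPos P v s) (v s)).im)
  change P.2 + _ = P.2 + ∫ s in 0..t, (inner ℂ _ _).im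
  simp_rw [← horizontalPos_neg, inner_neg_right, Complex.neg_im, intervalIntegral.integral_neg]
  rw [h, neg_zero, intervalIntegral.integral_symm]

theorem abs_integral_le_integral_symm {R t : ℝ} {g : ℝ → ℝ} (ht : |t| ≤ R)
    (hg : ∀ s, 0 ≤ g s) (hi : IntervalIntegrable g volume (-R) R) :
    |∫ s in 0..t, g s| ≤ ∫ s in (-R)..R, g s := by
  have hR : 0 ≤ R := (abs_nonneg t).trans ht
  rw [abs_le] at ht
  have hsub : Ι 0 t ⊆ Ι (-R) R := by
    rw [uIoc_of_le (by linarith : -R ≤ R)]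
    intro x hx
    rcases mem_uIoc.1 hx with h | h <;> constructor <;> linarith [h.1, h.2]
  have := intervalIntegral.abs_integral_mono_interval hsub (Eventually.of_forall hg) hi
  have h0 : 0 ≤ ∫ s in (-R)..R, g s :=
    intervalIntegral.integral_nonneg (by linarith) fun s _ => hg s
  rwa [abs_of_nonneg h0] at this

theorem norm_integral_le_integral_symm {E : Type*} [NormedAddCommGroup E] [NormedSpace ℝ E]
    {R t : ℝ} {g : ℝ → E} (ht : |t| ≤ R) (hi : IntervalIntegrable g volume (-R) R) :
    ‖∫ s in 0..t, g s‖ ≤ ∫ s in (-R)..R, ‖g s‖ :=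
  intervalIntegral.norm_integral_le_abs_integral_norm.trans
    (abs_integral_le_integral_symm ht (fun _ => norm_nonneg _) hi.norm)

/-- Horizontal curves depend continuously, uniformly on bounded intervals, on the control in the
`L¹` norm. -/
theorem exists_dist_horizontalCurve_le (P : W × ℝ) (hv : IntervalIntegrableOnLine v) {R ε : ℝ}
    (hR : 0 ≤ R) (hε : 0 < ε) :
    ∃ δ > 0, ∀ v' : ℝ → W, IntervalIntegrableOnLine v' →
      ∫ s in (-R)..R, ‖v' s - v s‖ ≤ δ →
      ∀ t, |t| ≤ R → dist (horizontalCurve P v' t) (horizontalCurve P v t) ≤ ε := by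
  set B := ∫ s in (-R)..R, ‖v s‖ with hB
  have hB0 : 0 ≤ B := intervalIntegral.integral_nonneg (by linarith) fun s _ => norm_nonneg _
  set M := ‖P.1‖ + B with hM
  have hM0 : 0 ≤ M := by positivity
  -- With `I` the `L¹` distance of the controls, the heights differ by at most `I * B + (I + M) *
  -- I`. The bound `I ≤ 1` turns this into `I * (B + M + 1)`.
  refine ⟨min (min 1 ε) (ε / (B + M + 1)), by positivity, fun v' hv' hI t ht => ?_⟩
  set I := ∫ s in (-R)..R, ‖v' s - v s‖ with hIdef
  have hI0 : 0 ≤ I := intervalIntegral.integral_nonneg (by linarith) fun s _ => norm_nonneg _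
  have hI1 : I ≤ 1 := hI.trans ((min_le_left _ _).trans (min_le_left _ _))
  have hI2 : I ≤ ε := hI.trans ((min_le_left _ _).trans (min_le_right _ _))
  have hI3 : I * (B + M + 1) ≤ ε := by
    rw [← le_div_iff₀ (by positivity)]
    exact hI.trans (min_le_right _ _)
  have hsub : IntervalIntegrableOnLine (fun s => v' s - v s) := fun a b => (hv' a b).sub (hv a b)
  have hpos : ∀ s, |s| ≤ R → ‖horizontalPos P v' s - horizontalPos P v s‖ ≤ I := by
    intro s hs
    rw [horizontalPos, horizontalPos, add_sub_add_left_eq_sub,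
      ← intervalIntegral.integral_sub (hv' _ _) (hv _ _)]
    exact norm_integral_le_integral_symm hs (hsub _ _)
  have hposM : ∀ s, |s| ≤ R → ‖horizontalPos P v s‖ ≤ M := fun s hs =>
    (norm_add_le _ _).trans (add_le_add_right (norm_integral_le_integral_symm hs (hv _ _)) _)
  have hi := intervalIntegrable_im_inner (continuous_horizontalPos (P := P) hv) hv
  have hi' := intervalIntegrable_im_inner (continuous_horizontalPos (P := P) hv') hv'
  have hbd : ∀ s ∈ Icc (-R) R, ‖(inner ℂ (horizontalPos P v' s) (v' s)).im -
      (inner ℂ (horizontalPos P v s) (v s)).im‖ ≤ I * ‖v s‖ + (I + M) * ‖v' s - v s‖ := by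
    intro s hs
    have hs' : |s| ≤ R := abs_le.2 hs
    have e : inner ℂ (horizontalPos P v' s) (v' s) - inner ℂ (horizontalPos P v s) (v s) =
        inner ℂ (horizontalPos P v' s - horizontalPos P v s) (v s) +
        inner ℂ (horizontalPos P v' s - horizontalPos P v s) (v' s - v s) +
          inner ℂ (horizontalPos P v s) (v' s - v s) := by
      simp only [inner_sub_left, inner_sub_right]; ring
    rw [← Complex.sub_im, e, Real.norm_eq_abs]
    refine (Complex.abs_im_le_norm _).trans ((norm_add₃_le).trans ?_)
    have a1 := (norm_inner_le_norm (𝕜 := ℂ) (horizontalPos P v' s - horizontalPos P v s) (v s)).trans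
      (mul_le_mul_of_nonneg_right (hpos s hs') (norm_nonneg _))
    have a2 := (norm_inner_le_norm (𝕜 := ℂ) (horizontalPos P v' s - horizontalPos P v s)
      (v' s - v s)).trans (mul_le_mul_of_nonneg_right (hpos s hs') (norm_nonneg _))
    have a3 := (norm_inner_le_norm (𝕜 := ℂ) (horizontalPos P v s) (v' s - v s)).trans
      (mul_le_mul_of_nonneg_right (hposM s hs') (norm_nonneg _))
    linarith
  have hheight : ‖horizontalHeight P v' t - horizontalHeight P v t‖ ≤ ε := by
    rw [horizontalHeight, horizontalHeight, add_sub_add_left_eq_sub,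
      ← intervalIntegral.integral_sub (hi' _ _) (hi _ _)]
    refine (norm_integral_le_integral_symm ht ((hi' _ _).sub (hi _ _))).trans ?_
    refine (intervalIntegral.integral_mono_on (by linarith) ((hi' _ _).sub (hi _ _)).norm
      (((hv _ _).norm.const_mul I).add ((hsub _ _).norm.const_mul (I + M))) hbd).trans ?_
    rw [intervalIntegral.integral_add ((hv _ _).norm.const_mul I) ((hsub _ _).norm.const_mul _),
      intervalIntegral.integral_const_mul, intervalIntegral.integral_const_mul, ← hB, ← hIdef]
    nlinarith
  rw [dist_eq_norm]
  exact max_le ((hpos t ht).trans hI2) hheight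

end HorizontalCurve

/-! ### Admissible controls -/

section Control

variable {W : Type*} [NormedAddCommGroup W]

/-- Admissible controls: measurable, locally bounded and almost everywhere continuous functions on
the line. -/
structure IsControl (v : ℝ → W) : Prop where
  stronglyMeasurable : StronglyMeasurable v
  bounded : ∀ T : ℝ, ∃ C : ℝ, ∀ t, |t| ≤ T → ‖v t‖ ≤ C
  ae_continuousAt : ∀ᵐ t, ContinuousAt v t

variable {v v' : ℝ → W}

theorem Continuous.isControl (hv : Continuous v) : IsControl v where
  stronglyMeasurable := hv.stronglyMeasurable
  bounded T := by
    obtain ⟨C, hC⟩ := (isCompact_Icc (a := -T) (b := T)).exists_bound_of_continuousOn hv.continuousOn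
    exact ⟨C, fun t ht => hC t (abs_le.1 ht)⟩
  ae_continuousAt := Eventually.of_forall fun t => hv.continuousAt

namespace IsControl

theorem intervalIntegrableOnLine (hv : IsControl v) : IntervalIntegrableOnLine v := by
  intro a b
  obtain ⟨C, hC⟩ := hv.bounded (max |a| |b|)
  rw [intervalIntegrable_iff]
  refine IntegrableOn.of_bound (by simp [uIoc]) hv.stronglyMeasurable.aestronglyMeasurable C ?_
  rw [ae_restrict_iff' measurableSet_uIoc]
  refine Eventually.of_forall fun t ht => hC t ?_
  rcases mem_uIoc.1 ht with h | h
  · exact abs_le_max_abs_abs h.1.le h.2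
  · rw [max_comm]; exact abs_le_max_abs_abs h.1.le h.2

theorem sub (hv : IsControl v) (hv' : IsControl v') : IsControl fun t => v t - v' t where
  stronglyMeasurable := hv.stronglyMeasurable.sub hv'.stronglyMeasurable
  bounded T := by
    obtain ⟨C, hC⟩ := hv.bounded T
    obtain ⟨C', hC'⟩ := hv'.bounded T
    exact ⟨C + C', fun t ht => (norm_sub_le _ _).trans (add_le_add (hC t ht) (hC' t ht))⟩
  ae_continuousAt := by
    filter_upwards [hv.ae_continuousAt, hv'.ae_continuousAt] with t h h' using h.sub h'

theorem ite_lt (hv : IsControl v) (hv' : IsControl v') (L : ℝ) :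
    IsControl fun t => if t < L then v t else v' t where
  stronglyMeasurable :=
    StronglyMeasurable.ite measurableSet_Iio hv.stronglyMeasurable hv'.stronglyMeasurable
  bounded T := by
    obtain ⟨C, hC⟩ := hv.bounded T
    obtain ⟨C', hC'⟩ := hv'.bounded T
    refine ⟨max C C', fun t ht => ?_⟩
    split_ifs
    · exact (hC t ht).trans (le_max_left _ _)
    · exact (hC' t ht).trans (le_max_right _ _)
  ae_continuousAt := by
    filter_upwards [hv.ae_continuousAt, hv'.ae_continuousAt,
      Measure.ae_ne volume L] with t h h' hL
    rcases lt_or_gt_of_ne hL with hlt | hlt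
    · refine h.congr ?_
      filter_upwards [Iio_mem_nhds hlt] with s hs
      exact (if_pos hs).symm
    · refine h'.congr ?_
      filter_upwards [Ioi_mem_nhds hlt] with s hs
      exact (if_neg (not_lt.2 (le_of_lt hs))).symm

theorem comp_add_left (hv : IsControl v) (r : ℝ) : IsControl fun t => v (r + t) where
  stronglyMeasurable := hv.stronglyMeasurable.comp_measurable (measurable_const_add r)
  bounded T := by
    obtain ⟨C, hC⟩ := hv.bounded (|r| + T)
    exact ⟨C, fun t ht => hC _ ((abs_add_le _ _).trans (by gcongr))⟩
  ae_continuousAt := by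
    filter_upwards [(measurePreserving_add_left volume r).quasiMeasurePreserving.ae
      hv.ae_continuousAt] with t ht
    exact ContinuousAt.comp (f := fun t => r + t) ht (by fun_prop)

theorem neg_comp_neg (hv : IsControl v) : IsControl fun t => -v (-t) where
  stronglyMeasurable := (hv.stronglyMeasurable.comp_measurable measurable_neg).neg
  bounded T := by
    obtain ⟨C, hC⟩ := hv.bounded T
    exact ⟨C, fun t ht => by rw [norm_neg]; exact hC _ (by rwa [abs_neg])⟩
  ae_continuousAt := by
    filter_upwards [(Measure.measurePreserving_neg (volume : Measure ℝ)).quasiMeasurePreserving.ae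
      hv.ae_continuousAt] with t ht
    exact (ContinuousAt.comp (f := fun t => -t) ht (by fun_prop)).neg

end IsControl

end Control

/-! ### Connectivity by horizontal polygons -/

section Connectivity

variable {W : Type*} [NormedAddCommGroup W] [InnerProductSpace ℂ W]

/-- `P` and `Q` are the endpoints of a horizontal line segment contained in `Ω`. -/
def HorizontalStep (Ω : Set (W × ℝ)) (P Q : W × ℝ) : Prop :=
  Q.2 - P.2 = (inner ℂ P.1 (Q.1 - P.1)).im ∧ segment ℝ P Q ⊆ Ω

/-- Translation of `P` by the horizontal vector with first component `d`. -/
noncomputable def horizontalTranslate (P : W × ℝ) (d : W) : W × ℝ :=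
  (P.1 + d, P.2 + (inner ℂ P.1 d).im)

variable {Ω : Set (W × ℝ)}

theorem HorizontalStep.symm {P Q : W × ℝ} (h : HorizontalStep Ω P Q) : HorizontalStep Ω Q P := by
  refine ⟨?_, by rw [segment_symm]; exact h.2⟩
  have e : inner ℂ Q.1 (P.1 - Q.1) =
      -inner ℂ P.1 (Q.1 - P.1) - inner ℂ (Q.1 - P.1) (Q.1 - P.1) := by
    simp only [inner_sub_left, inner_sub_right]; ring
  have h0 : (inner ℂ (Q.1 - P.1) (Q.1 - P.1)).im = 0 := inner_self_im (𝕜 := ℂ) _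
  rw [e, Complex.sub_im, Complex.neg_im, h0, ← h.1]
  ring

theorem horizontalStep_translate {P : W × ℝ} {d : W}
    (h : segment ℝ P (horizontalTranslate P d) ⊆ Ω) :
    HorizontalStep Ω P (horizontalTranslate P d) :=
  ⟨by simp [horizontalTranslate], h⟩

theorem horizontalTranslate_zero (P : W × ℝ) : horizontalTranslate P 0 = P := by
  simp [horizontalTranslate]

theorem Continuous.horizontalTranslate {X : Type*} [TopologicalSpace X] {f : X → W × ℝ} {d : X → W}
    (hf : Continuous f) (hd : Continuous d) :
    Continuous fun x => horizontalTranslate (f x) (d x) := by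
  unfold _root_.horizontalTranslate
  fun_prop

/-- A horizontal quadrilateral moves a point vertically. -/
theorem horizontalTranslate_quadrilateral {e : W} (he : ‖e‖ = 1) (P : W × ℝ) (a b : ℝ) :
    horizontalTranslate (horizontalTranslate (horizontalTranslate (horizontalTranslate P
      ((a : ℂ) • e)) ((b * Complex.I : ℂ) • e)) (-((a : ℂ) • e))) (-((b * Complex.I : ℂ) • e)) =
      (P.1, P.2 + 2 * (a * b)) := by
  refine Prod.ext (by simp only [horizontalTranslate]; abel) ?_
  have hee : inner ℂ e e = 1 := by rw [inner_self_eq_norm_sq_to_K, he]; simp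
  simp only [horizontalTranslate, inner_add_left, inner_neg_right, inner_neg_left, Complex.add_re,
    inner_smul_left, inner_smul_right, hee, map_mul, Complex.conj_ofReal, Complex.conj_I,
    Complex.add_im, Complex.neg_im, Complex.mul_im, Complex.mul_re, Complex.ofReal_re,
    Complex.ofReal_im, Complex.I_re, Complex.I_im, Complex.neg_re, Complex.one_re, Complex.one_im]
  ring

/-- One horizontal step brings the first component to that of `Q`. The remaining height error `δ Q`
is removed by a horizontal quadrilateral in the complex line of `e`, which is small when `Q` is near
`P`, so all the vertices stay in a ball inside `Ω`. -/
theorem eventually_reflTransGen_horizontalStep {e : W} (he : ‖e‖ = 1) (hΩ : IsOpen Ω) {P : W × ℝ}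
    (hP : P ∈ Ω) : ∀ᶠ Q in 𝓝 P, Relation.ReflTransGen (HorizontalStep Ω) P Q := by
  obtain ⟨r, hr, hball⟩ := Metric.isOpen_iff.1 hΩ P hP
  let δ : W × ℝ → ℝ := fun Q => Q.2 - P.2 - (inner ℂ P.1 (Q.1 - P.1)).im
  -- Since `√` vanishes on negative reals, only one of the two roots is nonzero. Hence `2ab = δ` for
  -- either sign, with `a` and `b` continuous and zero at `P`.
  let a : W × ℝ → ℝ := fun Q => √(δ Q) + √(-δ Q)
  let b : W × ℝ → ℝ := fun Q => (√(δ Q) - √(-δ Q)) / 2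
  have hab : ∀ Q, 2 * (a Q * b Q) = δ Q := by
    intro Q
    have : 2 * (a Q * b Q) = √(δ Q) ^ 2 - √(-δ Q) ^ 2 := by simp only [a, b]; ring
    rw [this]
    rcases le_total 0 (δ Q) with h | h
    · rw [Real.sq_sqrt h, Real.sqrt_eq_zero_of_nonpos (by linarith)]; ring
    · rw [Real.sq_sqrt (by linarith : 0 ≤ -δ Q), Real.sqrt_eq_zero_of_nonpos h]; ring
  have hδc : Continuous δ := by fun_prop
  have hac : Continuous a := by fun_prop
  have hbc : Continuous b := by fun_prop
  have hδP : δ P = 0 := by simp [δ]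
  have haP : a P = 0 := by simp [a, hδP]
  have hbP : b P = 0 := by simp [b, hδP]
  let X1 : W × ℝ → W × ℝ := fun Q => horizontalTranslate P (Q.1 - P.1)
  let X2 : W × ℝ → W × ℝ := fun Q => horizontalTranslate (X1 Q) ((a Q : ℂ) • e)
  let X3 : W × ℝ → W × ℝ := fun Q => horizontalTranslate (X2 Q) ((b Q * Complex.I : ℂ) • e)
  let X4 : W × ℝ → W × ℝ := fun Q => horizontalTranslate (X3 Q) (-((a Q : ℂ) • e))
  let X5 : W × ℝ → W × ℝ := fun Q => horizontalTranslate (X4 Q) (-((b Q * Complex.I : ℂ) • e))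
  have h1 : Continuous X1 := continuous_const.horizontalTranslate (by fun_prop)
  have h2 : Continuous X2 := h1.horizontalTranslate (by fun_prop)
  have h3 : Continuous X3 := h2.horizontalTranslate (by fun_prop)
  have h4 : Continuous X4 := h3.horizontalTranslate (by fun_prop)
  have h5 : Continuous X5 := h4.horizontalTranslate (by fun_prop)
  have e1 : X1 P = P := by simp [X1, horizontalTranslate_zero]
  have e2 : X2 P = P := by simp [X2, e1, haP, horizontalTranslate_zero]
  have e3 : X3 P = P := by simp [X3, e2, hbP, horizontalTranslate_zero]
  have e4 : X4 P = P := by simp [X4, e3, haP, horizontalTranslate_zero]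
  have e5 : X5 P = P := by simp [X5, e4, hbP, horizontalTranslate_zero]
  have key : ∀ X : W × ℝ → W × ℝ, Continuous X → X P = P →
      ∀ᶠ Q in 𝓝 P, X Q ∈ Metric.ball P r := fun X hX hXP =>
    hX.continuousAt.eventually_mem (by rw [hXP]; exact Metric.ball_mem_nhds _ hr)
  filter_upwards [key X1 h1 e1, key X2 h2 e2, key X3 h3 e3, key X4 h4 e4, key X5 h5 e5] with
    Q m1 m2 m3 m4 m5
  have hX5 : X5 Q = Q := by
    have := horizontalTranslate_quadrilateral he (X1 Q) (a Q) (b Q)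
    simp only [X5, X4, X3, X2, this, hab]
    simp only [X1, horizontalTranslate, δ]
    refine Prod.ext ?_ ?_ <;> simp
  have step : ∀ X : W × ℝ, ∀ d : W, X ∈ Metric.ball P r → horizontalTranslate X d ∈ Metric.ball P r →
      HorizontalStep Ω X (horizontalTranslate X d) := fun X d hX hXd =>
    horizontalStep_translate (((convex_ball P r).segment_subset hX hXd).trans hball)
  have s5 : Relation.ReflTransGen (HorizontalStep Ω) P (X5 Q) :=
    ((((Relation.ReflTransGen.single (step P _ (Metric.mem_ball_self hr) m1)).tail
      (step (X1 Q) _ m1 m2)).tail (step (X2 Q) _ m2 m3)).tail (step (X3 Q) _ m3 m4)).tail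
        (step (X4 Q) _ m4 m5)
  rwa [hX5] at s5

/-- Horizontal steps are reversible, so reachability is an equivalence relation. Its classes are
neighbourhoods of their points in `Ω`, and connectedness leaves only one class. -/
theorem IsPreconnected.reflTransGen_horizontalStep {e : W} (he : ‖e‖ = 1)
    (hc : IsPreconnected Ω) (hΩ : IsOpen Ω) {P Q : W × ℝ} (hP : P ∈ Ω) (hQ : Q ∈ Ω) :
    Relation.ReflTransGen (HorizontalStep Ω) P Q := by
  refine hc.induction₂ (Relation.ReflTransGen (HorizontalStep Ω)) (fun x hx => ?_)
    (fun x y z _ _ _ hxy hyz => hxy.trans hyz) (fun x y _ _ hxy => ?_) hP hQ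
  · exact nhdsWithin_le_nhds (eventually_reflTransGen_horizontalStep he hΩ hx)
  · have : Std.Symm (HorizontalStep Ω) := ⟨fun _ _ h => h.symm⟩
    exact Std.Symm.symm _ _ hxy

theorem horizontalCurve_const [CompleteSpace W] (P : W × ℝ) (d : W) (t : ℝ) :
    horizontalCurve P (fun _ => d) t = (P.1 + t • d, P.2 + t * (inner ℂ P.1 d).im) := by
  have hpos : ∀ s, horizontalPos P (fun _ => d) s = P.1 + s • d := by
    intro s
    simp [horizontalPos]
  refine Prod.ext (hpos t) ?_
  have hdd : (inner ℂ d d).im = 0 := inner_self_im (𝕜 := ℂ) _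
  change P.2 + _ = _
  have h : ∀ s : ℝ, (inner ℂ (P.1 + s • d) d).im = (inner ℂ P.1 d).im := by
    intro s
    rw [inner_add_left, ← Complex.coe_smul, inner_smul_left, Complex.add_im, Complex.conj_ofReal,
      Complex.im_ofReal_mul, hdd, mul_zero, add_zero]
  simp only [hpos, h, intervalIntegral.integral_const, sub_zero, smul_eq_mul]

theorem horizontalCurve_zero_control [CompleteSpace W] (P : W × ℝ) (t : ℝ) :
    horizontalCurve P (fun _ => 0) t = P := by
  simp [horizontalCurve_const]

/-- Points joined by a horizontal polygon in `Ω` are joined by a controlled horizontal curve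
in `Ω`. -/
theorem exists_isControl_of_reflTransGen [CompleteSpace W] {P Q : W × ℝ} (hP : P ∈ Ω)
    (h : Relation.ReflTransGen (HorizontalStep Ω) P Q) :
    ∃ v : ℝ → W, ∃ L : ℝ, IsControl v ∧ 0 ≤ L ∧ (∀ t, 0 ≤ t → horizontalCurve P v t ∈ Ω) ∧
      ∀ t, L ≤ t → horizontalCurve P v t = Q := by
  induction h with
  | refl =>
    refine ⟨fun _ => 0, 0, continuous_const.isControl, le_rfl, fun t _ => ?_, fun t _ => ?_⟩
    · rwa [horizontalCurve_zero_control]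
    · rw [horizontalCurve_zero_control]
  | @tail Q R _ hQR ih =>
    obtain ⟨v, L, hv, hL, hΩ, hend⟩ := ih
    set d := R.1 - Q.1 with hd
    -- The segment is traversed at constant velocity in unit time; zero control then keeps the curve
    -- at its endpoint.
    set w : ℝ → W := fun s => if s < 1 then d else 0 with hw
    have hwc : IsControl w := continuous_const.isControl.ite_lt continuous_const.isControl 1
    set v' : ℝ → W := fun s => if s < L then v s else w (-L + s) with hv'
    have hv'c : IsControl v' := hv.ite_lt (hwc.comp_add_left (-L)) L
    have hw1 : ∀ t, 0 ≤ t → t ≤ 1 → horizontalCurve Q w t ∈ segment ℝ Q R := by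
      intro t ht0 ht1
      have : horizontalCurve Q w t = horizontalCurve Q (fun _ => d) t := by
        refine horizontalCurve_congr ?_
        filter_upwards [Measure.ae_ne volume (1 : ℝ)] with s hs hst
        rw [uIoc_of_le ht0] at hst
        exact if_pos (lt_of_le_of_ne (hst.2.trans ht1) hs)
      rw [this, horizontalCurve_const, segment_eq_image']
      refine ⟨t, ⟨ht0, ht1⟩, Prod.ext (by simp [hd]) ?_⟩
      simp only [Prod.snd_add, Prod.smul_snd, Prod.snd_sub, smul_eq_mul, hd, hQR.1]
    have hw2 : ∀ t, 1 ≤ t → horizontalCurve Q w t = R := by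
      have h1 : horizontalCurve Q w 1 = R := by
        have : horizontalCurve Q w 1 = horizontalCurve Q (fun _ => d) 1 := by
          refine horizontalCurve_congr ?_
          filter_upwards [Measure.ae_ne volume (1 : ℝ)] with s hs hst
          rw [uIoc_of_le zero_le_one] at hst
          exact if_pos (lt_of_le_of_ne hst.2 hs)
        rw [this, horizontalCurve_const]
        refine Prod.ext (by simp [hd]) ?_
        simp only [one_mul, hd, ← hQR.1]
        ring
      intro t ht
      obtain ⟨s, rfl⟩ : ∃ s, t = 1 + s := ⟨t - 1, by ring⟩
      rw [horizontalCurve_add hwc.intervalIntegrableOnLine, h1]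
      refine Eq.trans (horizontalCurve_congr ?_) (horizontalCurve_zero_control R s)
      refine Eventually.of_forall fun x hx => ?_
      rw [uIoc_of_le (by linarith)] at hx
      exact if_neg (by linarith [hx.1])
    have hcur : ∀ t, 0 ≤ t → t ≤ L → horizontalCurve P v' t = horizontalCurve P v t := by
      intro t ht0 htL
      refine horizontalCurve_congr ?_
      filter_upwards [Measure.ae_ne volume L] with s hs hst
      rw [uIoc_of_le ht0] at hst
      exact if_pos (lt_of_le_of_ne (hst.2.trans htL) hs)
    have hcur' : ∀ s, 0 ≤ s → horizontalCurve P v' (L + s) = horizontalCurve Q w s := by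
      intro s hs
      rw [horizontalCurve_add hv'c.intervalIntegrableOnLine, hcur L hL le_rfl, hend L le_rfl]
      refine horizontalCurve_congr (Eventually.of_forall fun x hx => ?_)
      rw [uIoc_of_le hs] at hx
      simp only [hv']
      rw [if_neg (by linarith [hx.1]), neg_add_cancel_left]
    refine ⟨v', L + 1, hv'c, by linarith, fun t ht => ?_, fun t ht => ?_⟩
    · rcases le_total t L with htL | htL
      · rw [hcur t ht htL]
        exact hΩ t ht
      · obtain ⟨s, rfl⟩ : ∃ s, t = L + s := ⟨t - L, by ring⟩
        rw [hcur' s (by linarith)]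
        rcases le_total s 1 with hs | hs
        · exact hQR.2 (hw1 s (by linarith) hs)
        · rw [hw2 s hs]
          exact hQR.2 (right_mem_segment ℝ Q R)
    · obtain ⟨s, rfl⟩ : ∃ s, t = L + s := ⟨t - L, by ring⟩
      rw [hcur' s (by linarith), hw2 s (by linarith)]

end Connectivity

/-! ### Approximation of controls by entire functions -/

section GaussianApproximation

variable {W : Type*} [NormedAddCommGroup W] [NormedSpace ℂ W]

/-- The heat kernel, normalized to have integral one on the line. -/
noncomputable def heatKernel (c : ℝ) (z : ℂ) : ℂ :=
  ((c * (√Real.pi)⁻¹ : ℝ) : ℂ) * Complex.exp (-(c * z) ^ 2)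

/-- The convolution of a function on the line with the heat kernel, as a function on the plane. -/
noncomputable def heatConvolution (c : ℝ) (h : ℝ → W) (z : ℂ) : W :=
  ∫ s : ℝ, heatKernel c (z - s) • h s

theorem heatKernel_ofReal (c x : ℝ) :
    heatKernel c x = ((c * ((√Real.pi)⁻¹ * Real.exp (-(c * x) ^ 2)) : ℝ) : ℂ) := by
  simp [heatKernel, mul_assoc]

theorem norm_heatKernel {c : ℝ} (hc : 0 ≤ c) (z : ℂ) :
    ‖heatKernel c z‖ = c * (√Real.pi)⁻¹ * Real.exp (-(c ^ 2 * (z.re ^ 2 - z.im ^ 2))) := by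
  rw [heatKernel, norm_mul, Complex.norm_real, Real.norm_of_nonneg (by positivity),
    Complex.norm_exp]
  congr 2
  simp [pow_two]
  ring

theorem hasDerivAt_heatKernel (c : ℝ) (z : ℂ) :
    HasDerivAt (heatKernel c) (heatKernel c z * (-(2 * c ^ 2 * z))) z := by
  have h1 : HasDerivAt (fun z : ℂ => -((c : ℂ) * z) ^ 2) (-(2 * c ^ 2 * z)) z := by
    refine ((((hasDerivAt_id z).const_mul (c : ℂ)).pow 2).neg).congr_deriv ?_
    simp
    ring
  refine (h1.cexp.const_mul ((c * (√Real.pi)⁻¹ : ℝ) : ℂ)).congr_deriv ?_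
  simp only [heatKernel]
  ring

theorem continuous_heatKernel (c : ℝ) : Continuous (heatKernel c) := by
  unfold heatKernel; fun_prop

/-- Differentiation under the integral sign: the support of `h` is bounded, so the derivative of the
kernel is bounded uniformly for `z` in a unit ball. -/
theorem differentiable_heatConvolution (c : ℝ) {h : ℝ → W} (hh : Integrable h) {T : ℝ}
    (hsupp : ∀ s, T < |s| → h s = 0) : Differentiable ℂ (heatConvolution c h) := by
  intro z₀
  set K' : ℂ → ℝ → ℂ := fun z s => heatKernel c (z - s) * (-(2 * c ^ 2 * (z - s))) with hK'
  have hk := continuous_heatKernel c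
  have hK'c : Continuous (Function.uncurry K') := by
    simp only [hK', Function.uncurry_def]
    fun_prop
  obtain ⟨C, hC⟩ := ((isCompact_closedBall z₀ 1).prod
    (isCompact_Icc (a := -T) (b := T))).exists_bound_of_continuousOn hK'c.continuousOn
  have key := hasDerivAt_integral_of_dominated_loc_of_deriv_le (μ := volume) (𝕜 := ℂ)
    (F := fun z s => heatKernel c (z - s) • h s) (F' := fun z s => K' z s • h s) (x₀ := z₀)
    (s := Metric.ball z₀ 1) (bound := fun s => C * ‖h s‖) (Metric.ball_mem_nhds _ one_pos)
    (Eventually.of_forall fun z => ?_) ?_ ?_ ?_ (hh.norm.const_mul C) ?_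
  · exact key.2.differentiableAt
  · exact (Continuous.aestronglyMeasurable (by fun_prop)).smul hh.aestronglyMeasurable
  · obtain ⟨C', hC'⟩ := (isCompact_Icc (a := -T) (b := T)).exists_bound_of_continuousOn
      (f := fun s : ℝ => heatKernel c (z₀ - s)) (Continuous.continuousOn (by fun_prop))
    refine (hh.norm.const_mul C').mono'
      ((Continuous.aestronglyMeasurable (by fun_prop)).smul hh.aestronglyMeasurable)
      (Eventually.of_forall fun s => ?_)
    by_cases hs : T < |s|
    · simp [hsupp s hs]
    · rw [norm_smul]
      exact mul_le_mul_of_nonneg_right (hC' s (abs_le.1 (not_lt.1 hs))) (norm_nonneg _)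
  · exact (Continuous.aestronglyMeasurable (by fun_prop)).smul hh.aestronglyMeasurable
  · refine Eventually.of_forall fun s z hz => ?_
    by_cases hs : T < |s|
    · simp [hsupp s hs]
    · rw [norm_smul]
      exact mul_le_mul_of_nonneg_right
        (hC (z, s) ⟨Metric.ball_subset_closedBall hz, abs_le.1 (not_lt.1 hs)⟩) (norm_nonneg _)
  · refine Eventually.of_forall fun s z _ => ?_
    exact ((hasDerivAt_heatKernel c (z - s)).comp_sub_const z (s : ℂ)).smul_const (h s)

theorem integral_gaussian_normalized :
    ∫ x : ℝ, (√Real.pi)⁻¹ * Real.exp (-x ^ 2) = 1 := by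
  have := integral_gaussian 1
  simp only [neg_mul, one_mul, div_one] at this
  rw [integral_const_mul, this, inv_mul_cancel₀ (by positivity)]

theorem heatConvolution_ofReal (c : ℝ) (h : ℝ → W) (t : ℝ) :
    heatConvolution c h t =
      ∫ s : ℝ, (c * ((√Real.pi)⁻¹ * Real.exp (-(c * (t - s)) ^ 2))) • h s := by
  refine integral_congr_ae (Eventually.of_forall fun s => ?_)
  simp only [← Complex.ofReal_sub, heatKernel_ofReal, Complex.coe_smul]

theorem tendsto_heatConvolution {h : ℝ → W} (hh : Integrable h) [CompleteSpace W] {t : ℝ}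
    (ht : ContinuousAt h t) :
    Tendsto (fun c : ℝ => heatConvolution c h t) atTop (𝓝 (h t)) := by
  have := tendsto_integral_comp_smul_smul_of_integrable' (μ := volume) (F := ℝ)
    (φ := fun x : ℝ => (√Real.pi)⁻¹ * Real.exp (-x ^ 2)) (fun x => by positivity)
    integral_gaussian_normalized ?_ hh ht
  · simpa [heatConvolution_ofReal] using this
  · have h1 := (tendsto_rpow_abs_mul_exp_neg_mul_sq_cocompact one_pos 1).const_mul (√Real.pi)⁻¹
    rw [mul_zero, ← Metric.cobounded_eq_cocompact] at h1
    refine h1.congr fun x => ?_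
    simp
    ring

theorem integral_heatKernel {c : ℝ} (hc : 0 < c) (t : ℝ) :
    ∫ s : ℝ, c * ((√Real.pi)⁻¹ * Real.exp (-(c * (t - s)) ^ 2)) = 1 := by
  rw [integral_sub_left_eq_self (fun x => c * ((√Real.pi)⁻¹ * Real.exp (-(c * x) ^ 2))) volume t,
    integral_const_mul, Measure.integral_comp_mul_left
      (fun x => (√Real.pi)⁻¹ * Real.exp (-x ^ 2)) c, integral_gaussian_normalized, smul_eq_mul,
    mul_one, abs_of_pos (by positivity), mul_inv_cancel₀ hc.ne']

theorem norm_heatConvolution_ofReal_le {c C : ℝ} (hc : 0 < c) {h : ℝ → W}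
    (hC : ∀ s, ‖h s‖ ≤ C) (t : ℝ) : ‖heatConvolution c h t‖ ≤ C := by
  -- A non-integrable function has integral `0` by convention, whereas this one has integral `1`.
  have hi : Integrable (fun s : ℝ => c * ((√Real.pi)⁻¹ * Real.exp (-(c * (t - s)) ^ 2))) :=
    not_imp_comm.1 integral_undef (by rw [integral_heatKernel hc]; exact one_ne_zero)
  rw [heatConvolution_ofReal]
  refine (norm_integral_le_of_norm_le (hi.mul_const C) (Eventually.of_forall fun s => ?_)).trans ?_
  · rw [norm_smul, Real.norm_of_nonneg (by positivity)]
    exact mul_le_mul_of_nonneg_left (hC s) (by positivity)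
  · rw [integral_mul_const, integral_heatKernel hc, one_mul]

/-- The size of the kernel is governed by `Re² - Im²` of `z - s`. For `‖z‖ ≤ R / 2` and `|s| ≥ R`
this is at least `(R - |x|)² + x² - R² / 4 = 2 (|x| - R / 2)² + R² / 4`, where `x = Re z`. -/
theorem norm_heatConvolution_le {c R : ℝ} (hc : 0 < c) {h : ℝ → W} (hh : Integrable h)
    (hsupp : ∀ s, |s| < R → h s = 0) {z : ℂ} (hz : ‖z‖ ≤ R / 2) :
    ‖heatConvolution c h z‖ ≤
      c * (√Real.pi)⁻¹ * Real.exp (-(c ^ 2 * (R ^ 2 / 4))) * ∫ s, ‖h s‖ := by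
  rw [← integral_const_mul]
  refine norm_integral_le_of_norm_le (hh.norm.const_mul _) (Eventually.of_forall fun s => ?_)
  by_cases hs : |s| < R
  · simp [hsupp s hs]
  rw [norm_smul, norm_heatKernel hc.le]
  gcongr
  have h1 : z.re ^ 2 + z.im ^ 2 ≤ (R / 2) ^ 2 := by
    have := pow_le_pow_left₀ (norm_nonneg z) hz 2
    rw [Complex.sq_norm, Complex.normSq_apply] at this
    nlinarith
  have hR : 0 ≤ R := by linarith [norm_nonneg z]
  have h2 : |z.re| ≤ R / 2 := (Complex.abs_re_le_norm z).trans hz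
  have h3 : R - |z.re| ≤ |z.re - s| := by
    have := abs_sub_abs_le_abs_sub s z.re
    rw [abs_sub_comm] at this
    linarith [not_lt.1 hs]
  have h4 : (R - |z.re|) ^ 2 ≤ (z.re - s) ^ 2 := by
    rw [← sq_abs (z.re - s)]
    exact pow_le_pow_left₀ (by linarith) h3 2
  simp only [Complex.sub_re, Complex.ofReal_re, Complex.sub_im, Complex.ofReal_im, sub_zero]
  nlinarith [sq_abs z.re, sq_nonneg (|z.re| - R / 2)]

/-- A compactly supported control vanishing on `(-R, R)` is approximated in `L¹` by entire functions
that are uniformly small on the disc of radius `R / 2`. -/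
theorem IsControl.exists_entire_approx [CompleteSpace W] {h : ℝ → W} (hh : IsControl h) {R R' δ : ℝ}
    (hR : 0 < R) (hδ : 0 < δ) (hsupp : ∀ s, |s| < R → h s = 0) (hsupp' : ∀ s, R' < |s| → h s = 0) :
    ∃ H : ℂ → W, Differentiable ℂ H ∧ (∀ z, ‖z‖ ≤ R / 2 → ‖H z‖ ≤ δ) ∧
      ∫ s in (-R')..R', ‖H s - h s‖ ≤ δ := by
  obtain ⟨C, hC⟩ := hh.bounded R'
  have hC' : ∀ s, ‖h s‖ ≤ max C 0 := by
    intro s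
    by_cases hs : R' < |s|
    · simp [hsupp' s hs]
    · exact (hC s (not_lt.1 hs)).trans (le_max_left _ _)
  have hint : Integrable h := by
    have h1 : IntegrableOn h (Icc (-R') R') :=
      IntegrableOn.of_bound (by simp) hh.stronglyMeasurable.aestronglyMeasurable _
        (Eventually.of_forall hC')
    refine (integrableOn_iff_integrable_of_support_subset fun s hs => ?_).1 h1
    by_contra hcon
    exact hs (hsupp' s (not_le.1 fun h => hcon (abs_le.1 h)))
  -- Gaussian decay in `c` beats the factor `c` of the kernel.
  have t1 : Tendsto (fun c : ℝ => c * (√Real.pi)⁻¹ * Real.exp (-(c ^ 2 * (R ^ 2 / 4))) *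
      ∫ s, ‖h s‖) atTop (𝓝 0) := by
    have := ((tendsto_rpow_abs_mul_exp_neg_mul_sq_cocompact (a := R ^ 2 / 4) (by positivity) 1).mono_left
      atTop_le_cocompact).mul_const ((√Real.pi)⁻¹ * ∫ s, ‖h s‖)
    rw [zero_mul] at this
    refine this.congr' ?_
    filter_upwards [eventually_ge_atTop 0] with c hc
    rw [Real.rpow_one, abs_of_nonneg hc]
    ring_nf
  have t2 : Tendsto (fun c : ℝ => ∫ s in (-R')..R', ‖heatConvolution c h s - h s‖) atTop
      (𝓝 (∫ s in (-R')..R', (0 : ℝ))) := by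
    refine intervalIntegral.tendsto_integral_filter_of_dominated_convergence
      (fun _ => max C 0 + max C 0) ?_ ?_ (by simp) ?_
    · refine Eventually.of_forall fun c => ?_
      have := (differentiable_heatConvolution c hint hsupp').continuous
      exact (((this.comp Complex.continuous_ofReal).aestronglyMeasurable).sub
        hh.stronglyMeasurable.aestronglyMeasurable).norm
    · filter_upwards [eventually_gt_atTop 0] with c hc
      refine Eventually.of_forall fun s _ => ?_
      rw [norm_norm]
      exact (norm_sub_le _ _).trans (add_le_add (norm_heatConvolution_ofReal_le hc hC' s) (hC' s))
    -- Almost everywhere continuity of the control gives the pointwise convergence needed for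
    -- dominated convergence.
    · filter_upwards [hh.ae_continuousAt] with s hs _
      have := ((tendsto_heatConvolution hint hs).sub_const (h s)).norm
      simpa using this
  rw [intervalIntegral.integral_zero] at t2
  obtain ⟨c, h1, h2, hc⟩ := ((t1.eventually (Iic_mem_nhds hδ)).and
    ((t2.eventually (Iic_mem_nhds hδ)).and (eventually_gt_atTop 0))).exists
  exact ⟨heatConvolution c h, differentiable_heatConvolution c hint hsupp',
    fun z hz => (norm_heatConvolution_le hc hint hsupp hz).trans h1, h2⟩

end GaussianApproximation

/-! ### Injectivity by generic perturbation -/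

section GenericPerturbation

variable {W : Type*} [NormedAddCommGroup W] [InnerProductSpace ℂ W]

/-- The derivative of `ℓ z + μ (z ^ 2 + i z ^ 3)`. -/
noncomputable def perturbationVelocity (l : ℂ) (μ : ℝ) (z : ℂ) : ℂ :=
  l + μ * (2 * z + 3 * Complex.I * z ^ 2)

/-- The polynomial `ℓ z + μ (z ^ 2 + i z ^ 3)`. -/
noncomputable def perturbation (l : ℂ) (μ : ℝ) (z : ℂ) : ℂ :=
  l * z + μ * (z ^ 2 + Complex.I * z ^ 3)

/-- The control `v` perturbed in the direction `e`. -/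
noncomputable def perturbedControl (v : ℝ → W) (e : W) (l : ℂ) (μ : ℝ) (t : ℝ) : W :=
  v t + perturbationVelocity l μ t • e

theorem hasDerivAt_perturbation (l : ℂ) (μ : ℝ) (z : ℂ) :
    HasDerivAt (perturbation l μ) (perturbationVelocity l μ z) z := by
  have h := ((hasDerivAt_id z).const_mul l).add
    ((((hasDerivAt_id z).pow 2).add (((hasDerivAt_id z).pow 3).const_mul Complex.I)).const_mul
      (μ : ℂ))
  refine h.congr_deriv ?_
  simp [perturbationVelocity]
  left
  ring

variable {P : W × ℝ} {v : ℝ → W} {e : W}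

theorem Continuous.intervalIntegrableOnLine {E : Type*} [NormedAddCommGroup E] {v : ℝ → E}
    (hv : Continuous v) : IntervalIntegrableOnLine v :=
  fun _ _ => hv.intervalIntegrable _ _

theorem horizontalPos_perturbedControl [CompleteSpace W] (hv : Continuous v) (l : ℂ) (μ t : ℝ) :
    horizontalPos P (perturbedControl v e l μ) t = horizontalPos P v t + perturbation l μ t • e := by
  have h1 : ∫ s in (0 : ℝ)..t, perturbationVelocity l μ s • e = perturbation l μ t • e := by
    have hd : ∀ s : ℝ, HasDerivAt (fun s : ℝ => perturbation l μ s • e)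
        (perturbationVelocity l μ s • e) s := fun s =>
      ((hasDerivAt_perturbation l μ s).comp_ofReal).smul_const e
    rw [intervalIntegral.integral_eq_sub_of_hasDerivAt (fun s _ => hd s)
      (Continuous.intervalIntegrable (by unfold perturbationVelocity; fun_prop) _ _)]
    simp [perturbation]
  rw [horizontalPos, horizontalPos, add_assoc, ← h1, ← intervalIntegral.integral_add
    (hv.intervalIntegrable _ _)
    (Continuous.intervalIntegrable (by unfold perturbationVelocity; fun_prop) _ _)]
  rfl

theorem hasDerivAt_horizontalPos [CompleteSpace W] (hv : Continuous v) (t : ℝ) :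
    HasDerivAt (horizontalPos P v) (v t) t :=
  (intervalIntegral.integral_hasDerivAt_right (hv.intervalIntegrable _ _)
    (hv.stronglyMeasurableAtFilter _ _) hv.continuousAt).const_add _

/-- The coordinate in the direction `e` of a horizontal curve. -/
noncomputable def horizontalCoord (P : W × ℝ) (v : ℝ → W) (e : W) (t : ℝ) : ℂ :=
  inner ℂ e (horizontalPos P v t)

theorem hasDerivAt_horizontalCoord [CompleteSpace W] (hv : Continuous v) (t : ℝ) :
    HasDerivAt (horizontalCoord P v e) (inner ℂ e (v t)) t :=
  ((innerSL ℂ e).restrictScalars ℝ).hasFDerivAt.comp_hasDerivAt t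
    (hasDerivAt_horizontalPos (P := P) hv t)

/-- The slope of `z ^ 2 + i z ^ 3` between `s` and `t`. -/
noncomputable def perturbationSlope (s t : ℝ) : ℂ :=
  (s + t : ℂ) + Complex.I * (s ^ 2 + s * t + t ^ 2 : ℂ)

/-- The linear coefficient that makes the coordinate in the direction `e` of the perturbed curve
take equal values at the times `z.re` and `z.im`. -/
noncomputable def closingCoeff (P : W × ℝ) (v : ℝ → W) (e : W) (μ : ℝ) (z : ℂ) : ℂ :=
  -((horizontalCoord P v e z.im - horizontalCoord P v e z.re) / (z.im - z.re : ℂ)) -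
    μ * perturbationSlope z.re z.im

/-- Pairing the equality of positions with `e` gives an equation linear in `l`, whose coefficient `t
- s` is nonzero. Thus a double point at times `s`, `t` leaves a single candidate for `l`. -/
theorem eq_closingCoeff [CompleteSpace W] (he : ‖e‖ = 1) (hv : Continuous v) {l : ℂ} {μ s t : ℝ}
    (hst : s ≠ t) (h : horizontalPos P (perturbedControl v e l μ) s =
      horizontalPos P (perturbedControl v e l μ) t) : l = closingCoeff P v e μ ⟨s, t⟩ := by
  have hee : inner ℂ e e = 1 := by rw [inner_self_eq_norm_sq_to_K, he]; simp
  have h' := congrArg (fun y => inner ℂ e y) h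
  simp only [horizontalPos_perturbedControl hv, inner_add_right, inner_smul_right, hee, mul_one,
    perturbation] at h'
  have hne : (t - s : ℂ) ≠ 0 := by
    rw [sub_ne_zero]
    exact_mod_cast hst.symm
  simp only [closingCoeff, perturbationSlope, horizontalCoord]
  field_simp
  linear_combination -h'

/-- The difference of the heights at the times `z.im` and `z.re` of the perturbed curve whose
linear coefficient is the closing one. -/
noncomputable def closingHeight (P : W × ℝ) (v : ℝ → W) (e : W) (z : ℂ) (μ : ℝ) : ℝ :=
  horizontalHeight P (perturbedControl v e (closingCoeff P v e μ z) μ) z.im -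
    horizontalHeight P (perturbedControl v e (closingCoeff P v e μ z) μ) z.re

theorem measurable_closingCoeff [CompleteSpace W] (hv : Continuous v) :
    Measurable fun p : ℂ × ℝ => closingCoeff P v e p.2 p.1 := by
  have hx : Measurable (horizontalCoord P v e) :=
    (continuous_const.inner
      (continuous_horizontalPos hv.intervalIntegrableOnLine)).measurable
  have hre : Measurable fun p : ℂ × ℝ => p.1.re := Complex.measurable_re.comp measurable_fst
  have him : Measurable fun p : ℂ × ℝ => p.1.im := Complex.measurable_im.comp measurable_fst
  have h3 : Measurable fun p : ℂ × ℝ => perturbationSlope p.1.re p.1.im := by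
    unfold perturbationSlope
    exact Continuous.measurable (by fun_prop)
  exact ((((hx.comp him).sub (hx.comp hre)).div
    ((Complex.measurable_ofReal.comp him).sub (Complex.measurable_ofReal.comp hre))).neg).sub
      ((Complex.measurable_ofReal.comp measurable_snd).mul h3)

/-- Joint measurability is what the exchange of quantifiers by Fubini requires. -/
theorem measurable_closingHeight [CompleteSpace W] (hv : Continuous v) :
    Measurable fun p : ℂ × ℝ => closingHeight P v e p.1 p.2 := by
  have hpos := continuous_horizontalPos (P := P) hv.intervalIntegrableOnLine
  have hH : Continuous fun q : (ℂ × ℝ) × ℝ =>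
      horizontalHeight P (perturbedControl v e q.1.1 q.1.2) q.2 := by
    unfold horizontalHeight
    simp only [horizontalPos_perturbedControl hv]
    refine continuous_const.add ?_
    refine intervalIntegral.continuous_parametric_intervalIntegral_of_continuous
      (X := (ℂ × ℝ) × ℝ) (f := fun q s => (inner ℂ (horizontalPos P v s +
        perturbation q.1.1 q.1.2 s • e) (perturbedControl v e q.1.1 q.1.2 s)).im) ?_ continuous_snd
    unfold perturbation perturbedControl perturbationVelocity Function.uncurry
    fun_prop
  have hc : Measurable fun p : ℂ × ℝ => (closingCoeff P v e p.2 p.1, p.2) :=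
    (measurable_closingCoeff hv).prodMk measurable_snd
  have h1 := hH.measurable.comp (hc.prodMk (Complex.measurable_im.comp measurable_fst))
  have h2 := hH.measurable.comp (hc.prodMk (Complex.measurable_re.comp measurable_fst))
  exact h1.sub h2

/-- With the closing coefficient, `μ` multiplies the arc `ρ(τ) = τ² + iτ³ - βτ` in the complex line
of `e`. For distinct times `s`, `t` this arc closes up: `ρ(s) = ρ(t)`. The `μ²` term is the integral
of `Im (conj ρ * ρ')`, twice the enclosed signed area. The cubic term `iτ³` makes that area nonzero;
with `τ²` alone the arc would stay on a real line. -/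
theorem exists_closingHeight_eq [CompleteSpace W] (he : ‖e‖ = 1) (hv : Continuous v) (z : ℂ) :
    ∃ c₀ c₁ : ℝ, ∀ μ, closingHeight P v e z μ =
      c₀ + μ * c₁ + μ ^ 2 * ((z.im - z.re) ^ 5 / 30) := by
  have hee : inner ℂ e e = 1 := by rw [inner_self_eq_norm_sq_to_K, he]; simp
  have hpos := continuous_horizontalPos (P := P) hv.intervalIntegrableOnLine
  set s := z.re with hs
  set t := z.im with ht
  set α : ℂ := (horizontalCoord P v e t - horizontalCoord P v e s) / (t - s : ℂ) with hα
  set β : ℂ := perturbationSlope s t with hβ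
  set p₀ : ℝ → W := fun τ => horizontalPos P v τ - (α * τ) • e with hp₀
  set v₀ : ℝ → W := fun τ => v τ - α • e with hv₀
  set ρ : ℝ → ℂ := fun τ => τ ^ 2 + Complex.I * τ ^ 3 - β * τ with hρ
  set ρ' : ℝ → ℂ := fun τ => 2 * τ + 3 * Complex.I * τ ^ 2 - β with hρ'
  set g₀ : ℝ → ℝ := fun τ => (inner ℂ (p₀ τ) (v₀ τ)).im with hg₀
  set g₁ : ℝ → ℝ := fun τ =>
    (inner ℂ (p₀ τ) e * ρ' τ + (starRingEnd ℂ) (ρ τ) * inner ℂ e (v₀ τ)).im with hg₁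
  set g₂ : ℝ → ℝ := fun τ => τ ^ 4 - 2 * (s + t) * τ ^ 3 + (s ^ 2 + s * t + t ^ 2) * τ ^ 2 with hg₂
  have hc0 : Continuous g₀ := by fun_prop
  have hc1 : Continuous g₁ := by fun_prop
  have hc2 : Continuous g₂ := by fun_prop
  have hint2 : ∫ τ in s..t, g₂ τ = (t - s) ^ 5 / 30 := by
    have hd : ∀ τ, HasDerivAt (fun τ : ℝ => τ ^ 5 / 5 - (s + t) * τ ^ 4 / 2 +
        (s ^ 2 + s * t + t ^ 2) * τ ^ 3 / 3) (g₂ τ) τ := by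
      intro τ
      have := (((hasDerivAt_pow 5 τ).div_const 5).sub
        (((hasDerivAt_pow 4 τ).const_mul (s + t)).div_const 2)).add
          (((hasDerivAt_pow 3 τ).const_mul (s ^ 2 + s * t + t ^ 2)).div_const 3)
      refine this.congr_deriv ?_
      simp only [hg₂]
      norm_num
      ring
    rw [intervalIntegral.integral_eq_sub_of_hasDerivAt (fun τ _ => hd τ)
      (hc2.intervalIntegrable _ _)]
    ring
  refine ⟨∫ τ in s..t, g₀ τ, ∫ τ in s..t, g₁ τ, fun μ => ?_⟩
  have hpt : ∀ τ, (inner ℂ (horizontalPos P (perturbedControl v e (closingCoeff P v e μ z) μ) τ)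
      (perturbedControl v e (closingCoeff P v e μ z) μ τ)).im = g₀ τ + μ * g₁ τ + μ ^ 2 * g₂ τ := by
    intro τ
    have e1 : horizontalPos P (perturbedControl v e (closingCoeff P v e μ z) μ) τ =
        p₀ τ + ((μ : ℂ) * ρ τ) • e := by
      rw [horizontalPos_perturbedControl hv]
      simp only [closingCoeff, perturbation, hp₀, hρ, ← hs, ← ht, ← hα, ← hβ]
      module
    have e2 : perturbedControl v e (closingCoeff P v e μ z) μ τ =
        v₀ τ + ((μ : ℂ) * ρ' τ) • e := by
      simp only [closingCoeff, perturbedControl, perturbationVelocity, hv₀, hρ', ← hs, ← ht, ← hα,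
        ← hβ]
      module
    have e3 : ((starRingEnd ℂ) (ρ τ) * ρ' τ).im = g₂ τ := by
      simp only [hρ, hρ', hg₂, hβ, perturbationSlope, ← Complex.ofReal_pow]
      simp [-Complex.ofReal_pow]
      ring
    rw [e1, e2, inner_add_left, inner_add_right, inner_add_right, inner_smul_left,
      inner_smul_left, inner_smul_right, inner_smul_right, hee, map_mul, Complex.conj_ofReal]
    have e4 : inner ℂ (p₀ τ) (v₀ τ) + (μ : ℂ) * ρ' τ * inner ℂ (p₀ τ) e +
        ((μ : ℂ) * (starRingEnd ℂ) (ρ τ) * inner ℂ e (v₀ τ) +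
          (μ : ℂ) * (starRingEnd ℂ) (ρ τ) * ((μ : ℂ) * ρ' τ * 1)) =
        inner ℂ (p₀ τ) (v₀ τ) + (μ : ℂ) * (inner ℂ (p₀ τ) e * ρ' τ +
          (starRingEnd ℂ) (ρ τ) * inner ℂ e (v₀ τ)) +
            ((μ ^ 2 : ℝ) : ℂ) * ((starRingEnd ℂ) (ρ τ) * ρ' τ) := by
      push_cast; ring
    rw [e4, Complex.add_im, Complex.add_im, Complex.im_ofReal_mul, Complex.im_ofReal_mul, e3]
  have hi : ∀ a b : ℝ, IntervalIntegrable (fun τ => g₀ τ + μ * g₁ τ + μ ^ 2 * g₂ τ) volume a b :=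
    fun a b => Continuous.intervalIntegrable (by fun_prop) a b
  simp only [closingHeight, horizontalHeight, hpt, ← hs, ← ht]
  rw [add_sub_add_left_eq_sub, intervalIntegral.integral_interval_sub_left (hi _ _) (hi _ _),
    intervalIntegral.integral_add (Continuous.intervalIntegrable (by fun_prop) _ _)
      (Continuous.intervalIntegrable (by fun_prop) _ _),
    intervalIntegral.integral_add (Continuous.intervalIntegrable (by fun_prop) _ _)
      (Continuous.intervalIntegrable (by fun_prop) _ _),
    intervalIntegral.integral_const_mul, intervalIntegral.integral_const_mul, hint2]

theorem volume_closingHeight_eq_zero [CompleteSpace W] (he : ‖e‖ = 1) (hv : Continuous v) {z : ℂ}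
    (hz : z.re ≠ z.im) : volume {μ : ℝ | closingHeight P v e z μ = 0} = 0 := by
  obtain ⟨c₀, c₁, h⟩ := exists_closingHeight_eq (P := P) he hv z
  set k := (z.im - z.re) ^ 5 / 30 with hk
  have hk0 : k ≠ 0 := div_ne_zero (pow_ne_zero _ (sub_ne_zero.2 hz.symm)) (by norm_num)
  set p : Polynomial ℝ := Polynomial.C k * Polynomial.X ^ 2 + Polynomial.C c₁ * Polynomial.X +
    Polynomial.C c₀ with hp
  have hp0 : p ≠ 0 := by
    intro h0
    have := Polynomial.natDegree_quadratic (b := c₁) (c := c₀) hk0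
    rw [← hp, h0, Polynomial.natDegree_zero] at this
    omega
  have hfin : {μ : ℝ | closingHeight P v e z μ = 0} ⊆ {μ | p.IsRoot μ} := by
    intro μ hμ
    have hμ' : closingHeight P v e z μ = 0 := hμ
    rw [h] at hμ'
    simp only [Set.mem_ofPred_eq, Polynomial.IsRoot, hp, Polynomial.eval_add, Polynomial.eval_mul,
      Polynomial.eval_C, Polynomial.eval_pow, Polynomial.eval_X]
    linarith
  exact ((Polynomial.finite_setOfPred_isRoot hp0).subset hfin).measure_zero _

/-- For each pair of distinct times, the bad `μ` are roots of a nonzero quadratic and form a null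
set. By Fubini, for almost every `μ` the bad pairs are null. -/
theorem ae_volume_closing_eq_zero [CompleteSpace W] (he : ‖e‖ = 1) (hv : Continuous v) :
    ∀ᵐ μ : ℝ, volume {z : ℂ | z.re ≠ z.im ∧ closingHeight P v e z μ = 0} = 0 := by
  have hm : MeasurableSet {p : ℂ × ℝ | ¬ (p.1.re ≠ p.1.im ∧ closingHeight P v e p.1 p.2 = 0)} := by
    refine ((MeasurableSet.compl ?_).inter ?_).compl
    · exact measurableSet_eq_fun (Complex.measurable_re.comp measurable_fst)
        (Complex.measurable_im.comp measurable_fst)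
    · exact measurable_closingHeight hv (measurableSet_singleton 0)
  have h1 : ∀ᵐ z : ℂ, ∀ᵐ μ : ℝ, ¬ (z.re ≠ z.im ∧ closingHeight P v e z μ = 0) := by
    refine Eventually.of_forall fun z => ?_
    by_cases hz : z.re = z.im
    · exact Eventually.of_forall fun μ h => h.1 hz
    · have := volume_closingHeight_eq_zero (P := P) he hv hz
      rw [← compl_mem_ae_iff] at this
      filter_upwards [this] with μ hμ h using hμ h.2
  have h2 := (Measure.ae_ae_comm hm).1 h1
  filter_upwards [h2] with μ hμ
  rw [ae_iff] at hμ
  simpa using hμ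

/-- A generic small perturbation of a differentiable control yields an injective horizontal curve
with nowhere vanishing velocity. -/
theorem exists_perturbedControl_injective [CompleteSpace W] (P : W × ℝ) (he : ‖e‖ = 1)
    (hv : Differentiable ℝ v) {δ : ℝ} (hδ : 0 < δ) :
    ∃ l : ℂ, ∃ μ : ℝ, ‖l‖ < δ ∧ |μ| < δ ∧
      Function.Injective (horizontalCurve P (perturbedControl v e l μ)) ∧
      ∀ t, perturbedControl v e l μ t ≠ 0 := by
  have hvc := hv.continuous
  have hee : inner ℂ e e = 1 := by rw [inner_self_eq_norm_sq_to_K, he]; simp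
  obtain ⟨μ, hμ, hμδ⟩ := (Measure.dense_of_ae
    (ae_volume_closing_eq_zero (P := P) he hvc)).exists_dist_lt (0 : ℝ) hδ
  rw [dist_comm, dist_zero_right, Real.norm_eq_abs] at hμδ
  set S : Set ℂ := {z : ℂ | z.re ≠ z.im ∧ closingHeight P v e z μ = 0} with hS
  have hx : Differentiable ℝ (horizontalCoord P v e) := fun t =>
    (hasDerivAt_horizontalCoord hvc t).differentiableAt
  have him : Differentiable ℝ Complex.im := Complex.imCLM.differentiable
  have hre : Differentiable ℝ Complex.re := Complex.reCLM.differentiable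
  have hco : Differentiable ℝ (fun x : ℝ => (x : ℂ)) := Complex.ofRealCLM.differentiable
  have hcim : Differentiable ℝ (fun z : ℂ => (z.im : ℂ)) := hco.comp him
  have hcre : Differentiable ℝ (fun z : ℂ => (z.re : ℂ)) := hco.comp hre
  -- For this `μ`, the values of `l` that produce a double point form the image of a null set of
  -- pairs `(s, t)` under a differentiable map of the plane, hence a null set.
  have n1 : volume (closingCoeff P v e μ '' S) = 0 := by
    refine addHaar_image_eq_zero_of_differentiableOn_of_addHaar_eq_zero volume ?_ hμ
    intro z hz
    have hne : (z.im - z.re : ℂ) ≠ 0 := by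
      rw [sub_ne_zero]
      exact_mod_cast hz.1.symm
    have d1 : DifferentiableAt ℝ (fun z : ℂ =>
        (horizontalCoord P v e z.im - horizontalCoord P v e z.re) / (z.im - z.re : ℂ)) z := by
      simp only [div_eq_mul_inv]
      exact DifferentiableAt.fun_mul ((hx.comp him z).sub (hx.comp hre z))
        (DifferentiableAt.inv (h := fun z : ℂ => (z.im - z.re : ℂ)) ((hcim z).sub (hcre z)) hne)
    have d2 : DifferentiableAt ℝ (fun z : ℂ => (μ : ℂ) * perturbationSlope z.re z.im) z := by
      unfold perturbationSlope
      fun_prop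
    exact (d1.neg.sub d2).differentiableWithinAt
  -- If the velocity vanishes at time `t`, its `e`-component determines `l` from `t`; these values
  -- of `l` form a differentiable image of the real axis, which is null in `ℂ`.
  have n2 : volume ((fun z : ℂ => -(inner ℂ e (v z.re) + μ * (2 * z.re + 3 * Complex.I * z.re ^ 2)))
      '' {z : ℂ | z.im = 0}) = 0 := by
    refine addHaar_image_eq_zero_of_differentiableOn_of_addHaar_eq_zero volume ?_ ?_
    · have d1 : Differentiable ℝ (fun z : ℂ => inner ℂ e (v z.re)) := fun z =>
        (differentiableAt_const e).inner ℂ (hv.comp hre z)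
      exact Differentiable.differentiableOn (by fun_prop)
    · have : {z : ℂ | z.im = 0} = (LinearMap.ker Complex.imLm : Submodule ℝ ℂ) := by
        ext z; simp
      rw [this]
      refine Measure.addHaar_submodule _ _ fun htop => ?_
      have : Complex.I ∈ LinearMap.ker Complex.imLm := by rw [htop]; trivial
      simp at this
  obtain ⟨l, hl, hlδ⟩ := (Measure.dense_of_ae
    (compl_mem_ae_iff.2 (measure_union_null n1 n2))).exists_dist_lt (0 : ℂ) hδ
  rw [dist_comm, dist_zero_right] at hlδ
  refine ⟨l, μ, hlδ, hμδ, fun s t hst => ?_, fun t ht => hl (Or.inr ⟨t, by simp, ?_⟩)⟩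
  · by_contra hne
    have hl' := eq_closingCoeff (P := P) he hvc hne (congrArg Prod.fst hst)
    refine hl (Or.inl ⟨⟨s, t⟩, ⟨hne, ?_⟩, hl'.symm⟩)
    have := congrArg Prod.snd hst
    simp only [closingHeight, ← hl']
    exact sub_eq_zero.2 this.symm
  · have := congrArg (fun y => inner ℂ e y) ht
    simp only [perturbedControl, perturbationVelocity, inner_add_right, inner_smul_right, hee,
      inner_zero_right] at this
    simp only [Complex.ofReal_re]
    linear_combination -this

end GenericPerturbation

/-! ### The extension step -/

section HorizontalExtension

variable {W : Type*} [NormedAddCommGroup W] [InnerProductSpace ℂ W]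
  {Ω : Set (W × ℝ)} {P : W × ℝ} {e : W}

/-- The horizontal curve whose control is the restriction of `V` to the real line. -/
noncomputable def entireCurve (P : W × ℝ) (V : ℂ → W) : ℝ → W × ℝ :=
  horizontalCurve P fun t : ℝ => V t

theorem Differentiable.continuous_comp_ofReal {V : ℂ → W} (hV : Differentiable ℂ V) :
    Continuous fun t : ℝ => V t :=
  hV.continuous.comp Complex.continuous_ofReal

theorem continuous_entireCurve {V : ℂ → W} (hV : Differentiable ℂ V) :
    Continuous (entireCurve P V) :=
  continuous_horizontalCurve hV.continuous_comp_ofReal.intervalIntegrableOnLine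

theorem exists_pos_forall_dist_le_mem {M : Type*} [PseudoMetricSpace M] {Ω : Set M} {γ : ℝ → M}
    (hΩ : IsOpen Ω) (hγ : Continuous γ) {R : ℝ}
    (h : ∀ t, |t| ≤ R → γ t ∈ Ω) :
    ∃ δ > 0, ∀ t, |t| ≤ R → ∀ X, dist X (γ t) ≤ δ → X ∈ Ω := by
  have hK : IsCompact (γ '' Icc (-R) R) := isCompact_Icc.image hγ
  obtain ⟨δ, hδ, hsub⟩ := hK.exists_cthickening_subset_open hΩ (by
    rintro _ ⟨t, ht, rfl⟩
    exact h t (abs_le.2 ht))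
  exact ⟨δ, hδ, fun t ht X hX => hsub
    (Metric.mem_cthickening_of_dist_le X (γ t) δ _ ⟨t, abs_le.1 ht, rfl⟩ hX)⟩

/-- The control that follows `V` on `[-R, R]` and then moves along prescribed controls forward and
backward in time, up to time `T`, minus `V`. -/
noncomputable def extensionCorrection (V v₁ v₂ : ℝ → W) (R T : ℝ) (t : ℝ) : W :=
  if t < -T then 0 else if t < -R then -v₂ (-(R + t)) - V t else if t < R then 0 else
    if t < T then v₁ (-R + t) - V t else 0

theorem isControl_extensionCorrection {W : Type*} [NormedAddCommGroup W] {V v₁ v₂ : ℝ → W}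
    (hV : IsControl V) (h₁ : IsControl v₁) (h₂ : IsControl v₂) (R T : ℝ) :
    IsControl (extensionCorrection V v₁ v₂ R T) := by
  have h0 : IsControl fun _ : ℝ => (0 : W) := continuous_const.isControl
  have h2' : IsControl fun t => -v₂ (-(R + t)) := h₂.neg_comp_neg.comp_add_left R
  exact h0.ite_lt ((h2'.sub hV).ite_lt (h0.ite_lt (((h₁.comp_add_left (-R)).sub hV).ite_lt h0 T) R)
    (-R)) (-T)

/-- Controls leading to `Q` inside `Ω` are attached at both ends of the curve over `[-R, R]`. The
correction to `V` vanishes on `(-R, R)`, so its entire approximation barely changes `V` on the half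
disc radius; `L¹` stability keeps the new curve in `Ω` and its ends near `Q`. A small generic
perturbation then gives injectivity and nonzero velocity. -/
theorem exists_entire_extension [CompleteSpace W] (he : ‖e‖ = 1) (hΩ : IsOpen Ω)
    (hc : IsPreconnected Ω) {V : ℂ → W} (hV : Differentiable ℂ V) {R : ℝ} (hR : 1 ≤ R)
    (hin : ∀ t, |t| ≤ R → entireCurve P V t ∈ Ω) {Q : W × ℝ} (hQ : Q ∈ Ω) {ε : ℝ} (hε : 0 < ε) :
    ∃ V' : ℂ → W, ∃ R' : ℝ, Differentiable ℂ V' ∧ 2 * R ≤ R' ∧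
      (∀ z, ‖z‖ ≤ R / 2 → ‖V' z - V z‖ ≤ ε) ∧
      (∀ t, |t| ≤ R → dist (entireCurve P V' t) (entireCurve P V t) ≤ ε) ∧
      (∀ t, |t| ≤ R' → entireCurve P V' t ∈ Ω) ∧
      Function.Injective (entireCurve P V') ∧ (∀ t : ℝ, V' t ≠ 0) ∧
      (∃ t, R ≤ t ∧ t ≤ R' ∧ dist (entireCurve P V' t) Q ≤ ε) ∧
      ∃ t, R ≤ t ∧ t ≤ R' ∧ dist (entireCurve P V' (-t)) Q ≤ ε := by
  set U : ℝ → W := fun t => V t with hU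
  have hUc : Continuous U := hV.continuous_comp_ofReal
  have hp : horizontalCurve P U R ∈ Ω := hin R (by rw [abs_of_nonneg (by linarith)])
  have hm : horizontalCurve P U (-R) ∈ Ω := hin (-R) (by rw [abs_neg, abs_of_nonneg (by linarith)])
  obtain ⟨v₁, L₁, hv₁, hL₁, hv₁Ω, hv₁Q⟩ := exists_isControl_of_reflTransGen hp
    (hc.reflTransGen_horizontalStep he hΩ hp hQ)
  obtain ⟨v₂, L₂, hv₂, hL₂, hv₂Ω, hv₂Q⟩ := exists_isControl_of_reflTransGen hm
    (hc.reflTransGen_horizontalStep he hΩ hm hQ)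
  -- `T` doubles the radius and leaves time for both attached curves to reach `Q`.
  set T := max (2 * R) (R + max L₁ L₂) with hT
  have hT2 : 2 * R ≤ T := le_max_left _ _
  have hTL : R + max L₁ L₂ ≤ T := le_max_right _ _
  have hTL₁ : L₁ ≤ T - R := by linarith [le_max_left L₁ L₂]
  have hTL₂ : L₂ ≤ T - R := by linarith [le_max_right L₁ L₂]
  set h := extensionCorrection U v₁ v₂ R T with hh
  have hhc : IsControl h := isControl_extensionCorrection hUc.isControl hv₁ hv₂ R T
  have hsupp : ∀ s, |s| < R → h s = 0 := by
    intro s hs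
    rw [abs_lt] at hs
    simp only [hh, extensionCorrection]
    rw [if_neg (by linarith), if_neg (by linarith), if_pos hs.2]
  have hsupp' : ∀ s, T < |s| → h s = 0 := by
    intro s hs
    simp only [hh, extensionCorrection]
    rcases lt_abs.1 hs with h | h
    · rw [if_neg (by linarith), if_neg (by linarith), if_neg (by linarith), if_neg (by linarith)]
    · rw [if_pos (by linarith)]
  set v : ℝ → W := fun t => U t + h t with hv
  have hvI : IntervalIntegrableOnLine v := fun a b =>
    (hUc.intervalIntegrable a b).add (hhc.intervalIntegrableOnLine a b)
  have hcen : ∀ t, |t| ≤ R → horizontalCurve P v t = horizontalCurve P U t := by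
    intro t ht
    refine horizontalCurve_congr ?_
    filter_upwards [Measure.ae_ne volume R, Measure.ae_ne volume (-R)] with s hs1 hs2 hst
    have : |s| < R := by
      rw [abs_le] at ht
      rw [abs_lt]
      rcases mem_uIoc.1 hst with h' | h'
      · exact ⟨by linarith [h'.1], lt_of_le_of_ne (h'.2.trans ht.2) hs1⟩
      · exact ⟨by linarith [h'.1], by linarith [h'.2]⟩
    simp [hv, hsupp s this]
  have hfwd : ∀ s, 0 ≤ s → s ≤ T - R →
      horizontalCurve P v (R + s) = horizontalCurve (horizontalCurve P U R) v₁ s := by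
    intro s hs0 hsT
    rw [horizontalCurve_add hvI, hcen R (by rw [abs_of_nonneg (by linarith)])]
    refine horizontalCurve_congr ?_
    filter_upwards [Measure.ae_ne volume (T - R)] with x hx hxs
    rw [uIoc_of_le hs0] at hxs
    have hxT : x < T - R := lt_of_le_of_ne (hxs.2.trans hsT) hx
    simp only [hv, hh, extensionCorrection]
    rw [if_neg (by linarith [hxs.1]), if_neg (by linarith [hxs.1]), if_neg (by linarith [hxs.1]),
      if_pos (by linarith), neg_add_cancel_left, add_sub_cancel]
  have hbwd : ∀ s, 0 ≤ s → s ≤ T - R →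
      horizontalCurve P v (-(R + s)) = horizontalCurve (horizontalCurve P U (-R)) v₂ s := by
    intro s hs0 hsT
    rw [neg_add, horizontalCurve_add hvI,
      hcen (-R) (by rw [abs_neg, abs_of_nonneg (by linarith)]), horizontalCurve_neg]
    refine horizontalCurve_congr ?_
    filter_upwards [Measure.ae_ne volume (T - R)] with x hx hxs
    rw [uIoc_of_le hs0] at hxs
    have hxT : x < T - R := lt_of_le_of_ne (hxs.2.trans hsT) hx
    simp only [hv, hh, extensionCorrection]
    rw [if_neg (by linarith [hxs.1]), if_pos (by linarith [hxs.1]), add_sub_cancel, neg_neg]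
    congr 1
    ring
  have hvΩ : ∀ t, |t| ≤ T → horizontalCurve P v t ∈ Ω := by
    intro t ht
    rw [abs_le] at ht
    by_cases h1 : |t| ≤ R
    · rw [hcen t h1]
      exact hin t h1
    · rcases lt_abs.1 (not_le.1 h1) with h2 | h2
      · obtain ⟨s, rfl⟩ : ∃ s, t = R + s := ⟨t - R, by ring⟩
        rw [hfwd s (by linarith) (by linarith)]
        exact hv₁Ω s (by linarith)
      · obtain ⟨s, rfl⟩ : ∃ s, t = -(R + s) := ⟨-t - R, by ring⟩
        rw [hbwd s (by linarith) (by linarith)]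
        exact hv₂Ω s (by linarith)
  obtain ⟨ε₁, hε₁, hmargin⟩ :=
    exists_pos_forall_dist_le_mem hΩ (continuous_horizontalCurve (P := P) hvI) hvΩ
  obtain ⟨δ, hδ, hstab⟩ := exists_dist_horizontalCurve_le P hvI (R := T) (by linarith)
    (lt_min hε hε₁)
  have hT0 : 0 < T := by linarith
  -- Half of each tolerance goes to the approximation; the other half is left to the perturbation,
  -- through `c`.
  obtain ⟨H, hHd, hHs, hHi⟩ := hhc.exists_entire_approx (R := R) (R' := T)
    (δ := min (ε / 2) (δ / 2)) (by linarith) (by positivity) hsupp hsupp'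
  set c := min (ε / 2) (δ / (4 * T)) with hcdef
  have hc0 : 0 < c := by positivity
  have hV1d : Differentiable ℂ fun z => V z + H z := hV.add hHd
  have hV1r : Differentiable ℝ fun t : ℝ => V t + H t := fun t =>
    ((hV1d t).restrictScalars ℝ).comp t Complex.ofRealCLM.differentiableAt
  -- The denominator makes `|l + μ(2z + 3iz²)| ≤ c` on the disc of radius `T`.
  obtain ⟨l, μ, hl, hμ, hinj, hne⟩ := exists_perturbedControl_injective P he hV1r
    (δ := c / (1 + 2 * T + 3 * T ^ 2)) (by positivity)
  have hD : ∀ z : ℂ, ‖z‖ ≤ T → ‖perturbationVelocity l μ z • e‖ ≤ c := by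
    intro z hz
    rw [norm_smul, he, mul_one, perturbationVelocity]
    calc ‖l + μ * (2 * z + 3 * Complex.I * z ^ 2)‖
        ≤ ‖l‖ + |μ| * (2 * ‖z‖ + 3 * ‖z‖ ^ 2) := by
          refine (norm_add_le _ _).trans ?_
          rw [norm_mul, Complex.norm_real, Real.norm_eq_abs]
          gcongr
          refine (norm_add_le _ _).trans (le_of_eq ?_)
          simp
      _ ≤ c / (1 + 2 * T + 3 * T ^ 2) + c / (1 + 2 * T + 3 * T ^ 2) * (2 * T + 3 * T ^ 2) := by
          gcongr
      _ = c := by field_simp; ring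
  set V' : ℂ → W := fun z => V z + H z + perturbationVelocity l μ z • e with hV'
  have hV'd : Differentiable ℂ V' := by
    refine hV1d.add (Differentiable.smul_const ?_ e)
    unfold perturbationVelocity
    fun_prop
  have hV'c : Continuous fun t : ℝ => V' t := hV'd.continuous_comp_ofReal
  have hHc : Continuous fun t : ℝ => H t := hHd.continuous_comp_ofReal
  have hclose : ∀ t, |t| ≤ T →
      dist (entireCurve P V' t) (horizontalCurve P v t) ≤ min ε ε₁ := by
    refine hstab _ hV'c.intervalIntegrableOnLine ?_
    have hi1 : IntervalIntegrable (fun s : ℝ => ‖H s - h s‖) volume (-T) T :=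
      ((hHc.intervalIntegrable _ _).sub (hhc.intervalIntegrableOnLine _ _)).norm
    have hi2 : IntervalIntegrable (fun s : ℝ => ‖V' s - v s‖) volume (-T) T :=
      ((hV'c.intervalIntegrable _ _).sub (hvI _ _)).norm
    calc ∫ s in (-T)..T, ‖V' s - v s‖
        ≤ ∫ s in (-T)..T, (‖H s - h s‖ + c) := by
          refine intervalIntegral.integral_mono_on (by linarith) hi2
            (hi1.add intervalIntegrable_const) fun s hs => ?_
          have e1 : V' s - v s = (H s - h s) + perturbationVelocity l μ s • e := by
            simp only [hV', hv, hU]; abel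
          rw [e1]
          refine (norm_add_le _ _).trans (add_le_add_right (hD s ?_) _)
          rw [Complex.norm_real, Real.norm_eq_abs]
          exact abs_le.2 hs
      _ ≤ δ / 2 + 2 * T * (δ / (4 * T)) := by
          rw [intervalIntegral.integral_add hi1 intervalIntegrable_const,
            intervalIntegral.integral_const, smul_eq_mul]
          have : c ≤ δ / (4 * T) := min_le_right _ _
          have := hHi.trans (min_le_right _ _)
          have : (T - -T) * c ≤ 2 * T * (δ / (4 * T)) := by
            rw [sub_neg_eq_add, ← two_mul]; gcongr
          linarith
      _ = δ := by field_simp; ring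
  refine ⟨V', T, hV'd, hT2, fun z hz => ?_, fun t ht => ?_, fun t ht => ?_, hinj, hne, ?_, ?_⟩
  · have e1 : V' z - V z = H z + perturbationVelocity l μ z • e := by
      simp only [hV']; abel
    rw [e1]
    refine (norm_add_le _ _).trans ?_
    have := (hHs z hz).trans (min_le_left _ _)
    have := (hD z (by linarith)).trans (min_le_left _ _)
    linarith
  · have := (hclose t (by linarith)).trans (min_le_left _ _)
    rwa [hcen t ht] at this
  · exact hmargin t ht _ ((hclose t ht).trans (min_le_right _ _))
  · refine ⟨T, by linarith, le_rfl, ?_⟩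
    have h1 := (hclose T (by rw [abs_of_pos hT0])).trans (min_le_left _ _)
    have h2 := hfwd (T - R) (by linarith) le_rfl
    rw [hv₁Q _ hTL₁, add_sub_cancel] at h2
    rwa [h2] at h1
  · refine ⟨T, by linarith, le_rfl, ?_⟩
    have h1 := (hclose (-T) (by rw [abs_neg, abs_of_pos hT0])).trans (min_le_left _ _)
    have h2 := hbwd (T - R) (by linarith) le_rfl
    rw [hv₂Q _ hTL₂, add_sub_cancel] at h2
    rwa [h2] at h1

/-- An entire control whose curve stays in `Ω`, is injective and immersed on `[-R, R]`, in a way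
that is stable under perturbations of size `η`. -/
structure IsRobustControl (Ω : Set (W × ℝ)) (P : W × ℝ) (V : ℂ → W) (R η : ℝ) : Prop where
  differentiable : Differentiable ℂ V
  one_le : 1 ≤ R
  pos : 0 < η
  mem : ∀ t, |t| ≤ R → ∀ X, dist X (entireCurve P V t) ≤ η → X ∈ Ω
  speed : ∀ t : ℝ, |t| ≤ R → η < ‖V t‖
  separated : ∀ s t, |s| ≤ R → |t| ≤ R → 1 / R ≤ |s - t| →
    2 * η < dist (entireCurve P V s) (entireCurve P V t)

/-- Compactness of `[-R, R]` gives positive lower bounds for the margin in `Ω` and for the speed.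
Pairs of times at distance at least `1 / R` form a compact set off the diagonal, where injectivity
bounds the distance of the curve points from below. -/
theorem exists_isRobustControl (hΩ : IsOpen Ω) {V : ℂ → W} (hV : Differentiable ℂ V) {R : ℝ}
    (hR : 1 ≤ R) (hin : ∀ t, |t| ≤ R → entireCurve P V t ∈ Ω)
    (hinj : Function.Injective (entireCurve P V)) (hne : ∀ t : ℝ, V t ≠ 0) {η₀ : ℝ} (hη₀ : 0 < η₀) :
    ∃ η ≤ η₀, IsRobustControl Ω P V R η := by
  have hγ := continuous_entireCurve (P := P) hV
  obtain ⟨a, ha, hmem⟩ := exists_pos_forall_dist_le_mem hΩ hγ hin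
  obtain ⟨b, hb, hspeed⟩ := (isCompact_Icc (a := -R) (b := R)).exists_forall_le'
    hV.continuous_comp_ofReal.norm.continuousOn (a := 0) (fun t _ => norm_pos_iff.2 (hne t))
  have hK : IsCompact ((Icc (-R) R ×ˢ Icc (-R) R) ∩ {p : ℝ × ℝ | 1 / R ≤ |p.1 - p.2|}) :=
    (isCompact_Icc.prod isCompact_Icc).inter_right
      (isClosed_le continuous_const (by fun_prop))
  obtain ⟨c, hc, hsep⟩ := hK.exists_forall_le'
    (f := fun p => dist (entireCurve P V p.1) (entireCurve P V p.2)) (a := 0)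
    (Continuous.continuousOn (by fun_prop)) (fun p hp => dist_pos.2 fun h => by
      have h1 := hp.2
      simp only [Set.mem_ofPred_eq, hinj h, sub_self, abs_zero] at h1
      have : 0 < 1 / R := by positivity
      linarith)
  -- The fractions `b / 2` and `c / 3` make the inequalities `η < ‖V t‖` and `2 * η < dist` strict.
  have h1 : min (min a (b / 2)) (min (c / 3) η₀) ≤ a := (min_le_left _ _).trans (min_le_left _ _)
  have h2 : min (min a (b / 2)) (min (c / 3) η₀) ≤ b / 2 :=
    (min_le_left _ _).trans (min_le_right _ _)
  have h3 : min (min a (b / 2)) (min (c / 3) η₀) ≤ c / 3 :=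
    (min_le_right _ _).trans (min_le_left _ _)
  refine ⟨min (min a (b / 2)) (min (c / 3) η₀), (min_le_right _ _).trans (min_le_right _ _),
    hV, hR, by positivity, fun t ht X hX => hmem t ht X (hX.trans h1), fun t ht => ?_,
    fun s t hs ht hst => ?_⟩
  · linarith [hspeed t (abs_le.1 ht)]
  · linarith [hsep (s, t) ⟨⟨abs_le.1 hs, abs_le.1 ht⟩, hst⟩]

/-- One step of the inductive construction: a robust control is extended and approximated so that
the new curve visits the `ε`-neighbourhood of `Q` at large positive and negative times. -/
structure IsRobustExtension (P Q : W × ℝ) (V : ℂ → W) (R η : ℝ) (V' : ℂ → W) (R' η' : ℝ) :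
    Prop where
  radius : 2 * R ≤ R'
  margin : η' ≤ η / 2
  control : ∀ z, ‖z‖ ≤ R / 2 → ‖V' z - V z‖ ≤ η / 2
  curve : ∀ t, |t| ≤ R → dist (entireCurve P V' t) (entireCurve P V t) ≤ η / 2
  visit : ∃ t, R ≤ t ∧ t ≤ R' ∧ dist (entireCurve P V' t) Q ≤ η / 2
  visit_neg : ∃ t, R ≤ t ∧ t ≤ R' ∧ dist (entireCurve P V' (-t)) Q ≤ η / 2

theorem IsRobustControl.exists_extension [CompleteSpace W] (he : ‖e‖ = 1) (hΩ : IsOpen Ω)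
    (hc : IsPreconnected Ω) {V : ℂ → W} {R η : ℝ} (h : IsRobustControl Ω P V R η) {Q : W × ℝ}
    (hQ : Q ∈ Ω) : ∃ V' R' η', IsRobustControl Ω P V' R' η' ∧
      IsRobustExtension P Q V R η V' R' η' := by
  have hη := h.pos
  have hR := h.one_le
  obtain ⟨V', R', hd, hR', hctl, hcur, hin, hinj, hne, hv, hv'⟩ :=
    exists_entire_extension (P := P) he hΩ hc h.differentiable h.one_le
      (fun t ht => h.mem t ht _ (by rw [dist_self]; exact hη.le)) hQ (half_pos hη)
  obtain ⟨η', hη', hrob⟩ := exists_isRobustControl hΩ hd (by linarith) hin hinj hne (half_pos hη)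
  exact ⟨V', R', η', hrob, hR', hη', hctl, hcur, hv, hv'⟩

/-- The induction starts from the constant curve at `P`, extended towards `P` itself. -/
theorem exists_isRobustControl_of_mem [CompleteSpace W] (he : ‖e‖ = 1) (hΩ : IsOpen Ω)
    (hc : IsPreconnected Ω) (hP : P ∈ Ω) : ∃ V R η, IsRobustControl Ω P V R η := by
  obtain ⟨V', R', hd, hR', -, -, hin, hinj, hne, -, -⟩ :=
    exists_entire_extension (P := P) (V := fun _ => 0) he hΩ hc (differentiable_const _) le_rfl
      (fun t _ => by rwa [entireCurve, horizontalCurve_zero_control]) hP one_pos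
  obtain ⟨η', -, hrob⟩ := exists_isRobustControl hΩ hd (by linarith) hin hinj hne one_pos
  exact ⟨V', R', η', hrob⟩

end HorizontalExtension

/-! ### The limit curve -/

section HorizontalLimit

variable {W : Type*} [NormedAddCommGroup W] [InnerProductSpace ℂ W]
  {Ω : Set (W × ℝ)} {P : W × ℝ} {e : W}

/-- The sum telescopes: `η j / 2 ≤ η j - η (j + 1)`. All changes after stage `k` therefore fit
within the margin `η k`. -/
theorem dist_le_sub_of_succ {M : Type*} [PseudoMetricSpace M] {x : ℕ → M} {η : ℕ → ℝ} {k : ℕ}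
    (hη : ∀ j, η (j + 1) ≤ η j / 2) (hx : ∀ j, k ≤ j → dist (x (j + 1)) (x j) ≤ η j / 2)
    {j : ℕ} (hj : k ≤ j) : dist (x j) (x k) ≤ η k - η j := by
  induction j, hj using Nat.le_induction with
  | base => simp
  | succ j hj ih =>
    linarith [dist_triangle (x (j + 1)) (x j) (x k), hx j hj, hη j]

/-- In an open connected subset of the Heisenberg group there is an injective immersed
horizontal curve with entire control that clusters everywhere at both ends. -/
theorem exists_entireCurve_clusterPt [CompleteSpace W] [SecondCountableTopology W] (he : ‖e‖ = 1)
    (hΩ : IsOpen Ω) (hc : IsPreconnected Ω) (hP : P ∈ Ω) :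
    ∃ V : ℂ → W, Differentiable ℂ V ∧ (∀ t, entireCurve P V t ∈ Ω) ∧
      Function.Injective (entireCurve P V) ∧ (∀ t : ℝ, V t ≠ 0) ∧
      ∀ X ∈ Ω, MapClusterPt X atTop (entireCurve P V) ∧ MapClusterPt X atBot (entireCurve P V) := by
  have : Nonempty Ω := ⟨⟨P, hP⟩⟩
  set d : ℕ → Ω := TopologicalSpace.denseSeq Ω with hd
  let S := {s : (ℂ → W) × ℝ × ℝ // IsRobustControl Ω P s.1 s.2.1 s.2.2}
  -- The target at stage `k` is the first component of `k.unpair`, so each point of the dense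
  -- sequence is a target infinitely often.
  have hstep : ∀ (k : ℕ) (s : S), ∃ s' : S,
      IsRobustExtension P (d k.unpair.1 : W × ℝ) s.1.1 s.1.2.1 s.1.2.2 s'.1.1 s'.1.2.1 s'.1.2.2 := by
    intro k s
    obtain ⟨V', R', η', h1, h2⟩ := s.2.exists_extension he hΩ hc (d k.unpair.1).2
    exact ⟨⟨(V', R', η'), h1⟩, h2⟩
  choose next hnext using hstep
  obtain ⟨V₀, R₀, η₀, h₀⟩ := exists_isRobustControl_of_mem (P := P) he hΩ hc hP
  let seq : ℕ → S := fun k => Nat.rec ⟨(V₀, R₀, η₀), h₀⟩ next k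
  set U : ℕ → ℂ → W := fun k => (seq k).1.1 with hU
  set R : ℕ → ℝ := fun k => (seq k).1.2.1 with hR
  set η : ℕ → ℝ := fun k => (seq k).1.2.2 with hη
  have hrob : ∀ k, IsRobustControl Ω P (U k) (R k) (η k) := fun k => (seq k).2
  have hext : ∀ k, IsRobustExtension P (d k.unpair.1 : W × ℝ) (U k) (R k) (η k) (U (k + 1))
      (R (k + 1)) (η (k + 1)) := fun k => hnext k (seq k)
  have hRpow : ∀ k, (2 : ℝ) ^ k ≤ R k := by
    intro k
    induction k with
    | zero => simpa using (hrob 0).one_le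
    | succ k ih => rw [pow_succ]; linarith [(hext k).radius]
  have hRmono : Monotone R := monotone_nat_of_le_succ fun k => by
    linarith [(hext k).radius, (hrob k).one_le]
  have hRtop : Tendsto R atTop atTop :=
    tendsto_atTop_mono hRpow (tendsto_pow_atTop_atTop_of_one_lt one_lt_two)
  have hηhalf : ∀ k, η (k + 1) ≤ η k / 2 := fun k => (hext k).margin
  have hηpow : ∀ k, η k ≤ η 0 * (1 / 2) ^ k := by
    intro k
    induction k with
    | zero => simp
    | succ k ih => rw [pow_succ]; linarith [hηhalf k]
  have hη0 : Tendsto η atTop (𝓝 0) := by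
    refine squeeze_zero (fun k => (hrob k).pos.le) hηpow ?_
    simpa using (tendsto_pow_atTop_nhds_zero_of_lt_one (r := (1 / 2 : ℝ)) (by norm_num)
      (by norm_num)).const_mul (η 0)
  have hVclose : ∀ k j, k ≤ j → ∀ z, ‖z‖ ≤ R k / 2 → dist (U j z) (U k z) ≤ η k - η j := by
    intro k j hkj z hz
    refine dist_le_sub_of_succ (x := fun j => U j z) hηhalf (fun i hi => ?_) hkj
    rw [dist_eq_norm]
    exact (hext i).control z (hz.trans (by linarith [hRmono hi]))
  have hcclose : ∀ k j, k ≤ j → ∀ t, |t| ≤ R k →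
      dist (entireCurve P (U j) t) (entireCurve P (U k) t) ≤ η k - η j := by
    intro k j hkj t ht
    exact dist_le_sub_of_succ (x := fun j => entireCurve P (U j) t) hηhalf
      (fun i hi => (hext i).curve t (ht.trans (hRmono hi))) hkj
  have hlim : ∀ z, ∃ y, Tendsto (fun k => U k z) atTop (𝓝 y) := by
    intro z
    refine cauchySeq_tendsto_of_complete (Metric.cauchySeq_iff'.2 fun ε hε => ?_)
    obtain ⟨k, h1, h2⟩ := ((hη0.eventually (gt_mem_nhds hε)).and
      (hRtop.eventually_ge_atTop (2 * ‖z‖))).exists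
    exact ⟨k, fun j hj => by linarith [hVclose k j hj z (by linarith), (hrob j).pos]⟩
  choose V hV using hlim
  have hVk : ∀ k z, ‖z‖ ≤ R k / 2 → dist (V z) (U k z) ≤ η k := by
    intro k z hz
    refine le_of_tendsto ((hV z).dist tendsto_const_nhds) ?_
    filter_upwards [eventually_ge_atTop k] with j hj
    linarith [hVclose k j hj z hz, (hrob j).pos]
  have hVd : Differentiable ℂ V := by
    rw [← differentiableOn_univ]
    refine TendstoLocallyUniformlyOn.differentiableOn (φ := atTop) (F := U) ?_
      (Eventually.of_forall fun k => (hrob k).differentiable.differentiableOn) isOpen_univ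
    rw [tendstoLocallyUniformlyOn_univ, Metric.tendstoLocallyUniformly_iff]
    intro ε hε z
    refine ⟨Metric.ball z 1, Metric.ball_mem_nhds _ one_pos, ?_⟩
    filter_upwards [hη0.eventually (gt_mem_nhds hε),
      hRtop.eventually_ge_atTop (2 * (‖z‖ + 1))] with k h1 h2 y hy
    refine (hVk k y ?_).trans_lt h1
    have : ‖y‖ ≤ ‖z‖ + ‖y - z‖ := by
      have := norm_add_le z (y - z)
      rwa [add_sub_cancel] at this
    rw [Metric.mem_ball, dist_eq_norm] at hy
    linarith
  -- The limit of the curves is the curve of the limit control: uniform convergence of the controls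
  -- on a bounded interval implies `L¹` convergence there.
  have hclim : ∀ t, Tendsto (fun k => entireCurve P (U k) t) atTop (𝓝 (entireCurve P V t)) := by
    intro t
    rw [Metric.tendsto_atTop']
    intro ε hε
    obtain ⟨δ, hδ, hstab⟩ := exists_dist_horizontalCurve_le P
      hVd.continuous_comp_ofReal.intervalIntegrableOnLine (R := |t| + 1) (by positivity)
      (half_pos hε)
    obtain ⟨N, hN⟩ := eventually_atTop.1 ((hη0.eventually
      (gt_mem_nhds (show 0 < δ / (2 * (|t| + 1)) by positivity))).and
        (hRtop.eventually_ge_atTop (2 * (|t| + 1))))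
    refine ⟨N, fun k hk => (hstab _
      (hrob k).differentiable.continuous_comp_ofReal.intervalIntegrableOnLine ?_ t
        (by linarith)).trans_lt (half_lt_self hε)⟩
    obtain ⟨h1, h2⟩ := hN k hk.le
    have hcont : Continuous fun s : ℝ => ‖U k s - V s‖ :=
      ((hrob k).differentiable.continuous_comp_ofReal.sub hVd.continuous_comp_ofReal).norm
    have hmono : ∫ s in (-(|t| + 1))..(|t| + 1), ‖U k s - V s‖ ≤
        ∫ s in (-(|t| + 1))..(|t| + 1), η k := by
      refine intervalIntegral.integral_mono_on (by linarith [abs_nonneg t])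
        (hcont.intervalIntegrable _ _) intervalIntegrable_const fun s hs => ?_
      rw [← dist_eq_norm, dist_comm]
      refine hVk k s ?_
      rw [Complex.norm_real, Real.norm_eq_abs]
      linarith [abs_le.2 hs]
    refine hmono.trans ?_
    rw [intervalIntegral.integral_const, smul_eq_mul, sub_neg_eq_add, ← two_mul]
    rw [lt_div_iff₀ (by positivity)] at h1
    linarith
  have hck : ∀ k t, |t| ≤ R k → dist (entireCurve P V t) (entireCurve P (U k) t) ≤ η k := by
    intro k t ht
    refine le_of_tendsto ((hclim t).dist tendsto_const_nhds) ?_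
    filter_upwards [eventually_ge_atTop k] with j hj
    linarith [hcclose k j hj t ht, (hrob j).pos]
  have hvisit : ∀ X ∈ Ω, ∀ s ∈ 𝓝 X, ∀ a : ℝ, ∃ k, a ≤ R k ∧
      ∀ t, |t| ≤ R (k + 1) →
        dist (entireCurve P (U (k + 1)) t) (d k.unpair.1 : W × ℝ) ≤ η k / 2 →
          entireCurve P V t ∈ s := by
    intro X hX s hs a
    obtain ⟨ε, hε, hball⟩ := Metric.mem_nhds_iff.1 hs
    obtain ⟨i, hi⟩ := (TopologicalSpace.denseRange_denseSeq Ω).exists_dist_lt ⟨X, hX⟩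
      (half_pos hε)
    obtain ⟨N, hN⟩ := eventually_atTop.1 ((hη0.eventually (gt_mem_nhds (half_pos hε))).and
      (hRtop.eventually_ge_atTop a))
    -- The stage `Nat.pair i N` has target `d i` and is at least `N`, hence is late enough for both
    -- estimates.
    obtain ⟨h1, h2⟩ := hN (Nat.pair i N) (Nat.right_le_pair i N)
    refine ⟨Nat.pair i N, h2, fun t ht hdist => hball ?_⟩
    rw [Nat.unpair_pair] at hdist
    have hi' : dist X (d i : W × ℝ) < ε / 2 := hi
    rw [Metric.mem_ball]
    have t1 := dist_triangle (entireCurve P V t) (entireCurve P (U (Nat.pair i N + 1)) t) X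
    have t2 := dist_triangle_right (entireCurve P (U (Nat.pair i N + 1)) t) X (d i : W × ℝ)
    linarith [hck (Nat.pair i N + 1) t ht, hηhalf (Nat.pair i N)]
  refine ⟨V, hVd, fun t => ?_, fun s t hst => ?_, fun t ht => ?_, fun X hX => ⟨?_, ?_⟩⟩
  · obtain ⟨k, hk⟩ := (hRtop.eventually_ge_atTop |t|).exists
    exact (hrob k).mem t hk _ (hck k t hk)
  -- At a stage with `1 / R k ≤ |s - t|` the two points are more than `2 * η k` apart, and passing
  -- to the limit moves each by at most `η k`.
  · by_contra hne
    have hpos : 0 < |s - t| := abs_pos.2 (sub_ne_zero.2 hne)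
    obtain ⟨k, h1, h2, h3⟩ := ((hRtop.eventually_ge_atTop |s|).and
      ((hRtop.eventually_ge_atTop |t|).and (hRtop.eventually_ge_atTop (1 / |s - t|)))).exists
    have h4 : 1 / R k ≤ |s - t| := by
      rw [one_div_le (by linarith [(hrob k).one_le]) hpos]
      exact h3
    have h5 := (hrob k).separated s t h1 h2 h4
    have h6 := hck k s h1
    have h7 := hck k t h2
    rw [← hst] at h7
    linarith [dist_triangle_left (entireCurve P (U k) s) (entireCurve P (U k) t)
      (entireCurve P V s)]
  · obtain ⟨k, hk⟩ := (hRtop.eventually_ge_atTop (2 * |t|)).exists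
    have h1 := (hrob k).speed t (by linarith [abs_nonneg t])
    have h2 := hVk k t (by rw [Complex.norm_real, Real.norm_eq_abs]; linarith)
    rw [ht, dist_zero_left] at h2
    linarith
  · rw [mapClusterPt_iff_frequently]
    intro s hs
    rw [frequently_atTop]
    intro a
    obtain ⟨k, hk, hmem⟩ := hvisit X hX s hs a
    obtain ⟨t, ht1, ht2, ht3⟩ := (hext k).visit
    refine ⟨t, hk.trans ht1, hmem t ?_ ht3⟩
    rwa [abs_of_nonneg (by linarith [(hrob k).one_le])]
  · rw [mapClusterPt_iff_frequently]
    intro s hs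
    rw [frequently_atBot]
    intro a
    obtain ⟨k, hk, hmem⟩ := hvisit X hX s hs (-a)
    obtain ⟨t, ht1, ht2, ht3⟩ := (hext k).visit_neg
    refine ⟨-t, by linarith, hmem (-t) ?_ ht3⟩
    rwa [abs_neg, abs_of_nonneg (by linarith [(hrob k).one_le])]

end HorizontalLimit

/-! ### Primitives of real-analytic functions -/

section AnalyticPrimitive

variable {F : Type*} [NormedAddCommGroup F] [NormedSpace ℝ F] [CompleteSpace F]

/-- A primitive of a real-analytic function is real-analytic. -/
theorem AnalyticAt.of_hasDerivAt {a g : ℝ → F} {x : ℝ} (ha : AnalyticAt ℝ a x)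
    (hg : ∀ᶠ y in 𝓝 x, HasDerivAt g (a y) y) : AnalyticAt ℝ g x := by
  obtain ⟨p, hp⟩ := id ha
  obtain ⟨ρ, hρ0, hρ⟩ := ENNReal.lt_iff_exists_nnreal_btwn.1 hp.radius_pos
  have hsum := p.summable_norm_mul_pow hρ
  obtain ⟨ε, hε, hball⟩ := Metric.eventually_nhds_iff.1
    (hg.and ha.eventually_analyticAt)
  obtain ⟨ε', hε', hball'⟩ := Metric.eventually_nhds_iff.1 (hasFPowerSeriesAt_iff.1 hp)
  -- Coefficients of the series integrated term by term, with constant term `g x`.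
  let b : ℕ → F := fun n => Nat.casesOn n (g x) fun n => ((n : ℝ) + 1)⁻¹ • p.coeff n
  let p' : FormalMultilinearSeries ℝ ℝ F := fun n =>
    ContinuousMultilinearMap.mkPiRing ℝ (Fin n) (b n)
  have hcoeff : ∀ n, p'.coeff n = b n := fun n => by
    simp [p', FormalMultilinearSeries.coeff]
  refine ⟨p', hasFPowerSeriesAt_iff.2 (Metric.eventually_nhds_iff.2
    ⟨min (min ε ε') ρ, by
      have : (0 : ℝ) < ρ := by exact_mod_cast hρ0
      positivity, fun y hy => ?_⟩)⟩
  rw [dist_zero_right, Real.norm_eq_abs, lt_min_iff, lt_min_iff] at hy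
  obtain ⟨⟨hy1, hy2⟩, hy3⟩ := hy
  have habs : ∀ t ∈ uIcc 0 y, |t| ≤ |y| := fun t ht => by
    simpa using abs_sub_left_of_mem_uIcc ht
  have hint : ∫ t in (0 : ℝ)..y, a (x + t) = g (x + y) - g x := by
    have := intervalIntegral.integral_eq_sub_of_hasDerivAt (a := 0) (b := y)
      (f := fun t => g (x + t)) (f' := fun t => a (x + t)) (fun t ht => ?_) ?_
    · simpa using this
    · have := (hball (y := x + t) (by
        rw [dist_self_add_left, Real.norm_eq_abs]; exact (habs t ht).trans_lt hy1)).1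
      exact this.comp_const_add x t
    · refine ContinuousOn.intervalIntegrable fun t ht => ?_
      have := (hball (y := x + t) (by
        rw [dist_self_add_left, Real.norm_eq_abs]; exact (habs t ht).trans_lt hy1)).2.continuousAt
      exact (ContinuousAt.comp (f := fun t => x + t) this (by fun_prop)).continuousWithinAt
  have key : HasSum (fun n => ∫ t in (0 : ℝ)..y, t ^ n • p.coeff n) (g (x + y) - g x) := by
    rw [← hint]
    refine intervalIntegral.hasSum_integral_of_dominated_convergence
      (fun n _ => ‖p n‖ * (ρ : ℝ) ^ n) (fun n => ?_) (fun n => ?_) ?_ ?_ ?_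
    · exact Continuous.aestronglyMeasurable (by fun_prop)
    · refine Eventually.of_forall fun t ht => ?_
      rw [norm_smul, norm_pow, Real.norm_eq_abs, mul_comm,
        FormalMultilinearSeries.norm_apply_eq_norm_coef]
      gcongr
      exact (habs t (uIoc_subset_uIcc ht)).trans hy3.le
    · exact Eventually.of_forall fun t _ => hsum
    · exact intervalIntegrable_const
    · refine Eventually.of_forall fun t ht => hball' ?_
      rw [dist_zero_right, Real.norm_eq_abs]
      exact (habs t (uIoc_subset_uIcc ht)).trans_lt hy2
  have hterm : ∀ n, y ^ (n + 1) • p'.coeff (n + 1) = ∫ t in (0 : ℝ)..y, t ^ n • p.coeff n := by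
    intro n
    rw [hcoeff, intervalIntegral.integral_smul_const, integral_pow]
    simp [b, smul_smul, div_eq_mul_inv]
  have h0 : HasSum (fun n => y ^ (n + 1) • p'.coeff (n + 1)) (g (x + y) - g x) := by
    simpa only [hterm] using key
  have := (hasSum_nat_add_iff (f := fun n => y ^ n • p'.coeff n) 1).1 h0
  simpa [hcoeff, b] using this

end AnalyticPrimitive

/-! ### The Cayley transform and the contact structure -/

section Cayley

variable {W : Type*} [NormedAddCommGroup W] [InnerProductSpace ℂ W]

/-- The denominator `-2u + i (1 + |w|²)` of the Cayley transform. -/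
noncomputable def cayleyDenom (X : W × ℝ) : ℂ :=
  -(2 * X.2 : ℂ) + (1 + inner ℂ X.1 X.1) * Complex.I

theorem cayleyDenom_im (X : W × ℝ) : (cayleyDenom X).im = 1 + ‖X.1‖ ^ 2 := by
  rw [cayleyDenom, inner_self_eq_norm_sq_to_K]
  simp [← Complex.ofReal_pow]

theorem cayleyDenom_re (X : W × ℝ) : (cayleyDenom X).re = -(2 * X.2) := by
  rw [cayleyDenom, inner_self_eq_norm_sq_to_K]
  simp [← Complex.ofReal_pow]

theorem cayleyDenom_ne_zero (X : W × ℝ) : cayleyDenom X ≠ 0 := by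
  intro h
  have := cayleyDenom_im X
  rw [h, Complex.zero_im] at this
  nlinarith [sq_nonneg ‖X.1‖]

theorem conj_cayleyDenom (X : W × ℝ) : (starRingEnd ℂ) (cayleyDenom X) =
    -(2 * X.2 : ℂ) - (1 + inner ℂ X.1 X.1) * Complex.I := by
  rw [cayleyDenom, inner_self_eq_norm_sq_to_K]
  simp only [map_add, map_neg, map_mul, map_one, map_ofNat, map_pow, Complex.conj_I,
    RCLike.conj_ofReal, Complex.conj_ofReal]
  ring

theorem continuous_cayleyDenom : Continuous (cayleyDenom : W × ℝ → ℂ) := by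
  unfold cayleyDenom
  fun_prop

/-- With `b = ⟪w, w'⟫`, the derivative is `-2 Im b + 2i Re b = 2i b`. Horizontality is exactly what
makes the two real parts combine into a multiple of `b`. -/
theorem hasDerivAt_cayleyDenom {w : ℝ → W} {u : ℝ → ℝ} {w' : W} {t : ℝ} (hw : HasDerivAt w w' t)
    (hu : HasDerivAt u (inner ℂ (w t) w').im t) :
    HasDerivAt (fun s => cayleyDenom (w s, u s)) (2 * Complex.I * inner ℂ (w t) w') t := by
  have h1 : HasDerivAt (fun s => inner ℂ (w s) (w s))
      (inner ℂ (w t) w' + inner ℂ w' (w t)) t := hw.inner ℂ hw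
  have h2 := ((hu.ofReal_comp.const_mul (2 : ℂ)).neg).add ((h1.const_add 1).mul_const Complex.I)
  refine h2.congr_deriv ?_
  rw [← inner_conj_symm w' (w t)]
  generalize inner ℂ (w t) w' = b
  apply Complex.ext
  · simp
  · simp
    ring

variable {E : Type*} [NormedAddCommGroup E] [InnerProductSpace ℂ E] {q : E}

/-- The Cayley transform, from the Heisenberg group `(ℂ q)ᗮ × ℝ` to the unit sphere. -/
noncomputable def cayley (q : E) (X : (Submodule.span ℂ {q})ᗮ × ℝ) : E :=
  q + (2 / cayleyDenom X) • ((X.1 : E) - Complex.I • q)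

theorem inner_orthogonal_span_right (w : (Submodule.span ℂ {q})ᗮ) : inner ℂ q (w : E) = 0 :=
  Submodule.mem_orthogonal_singleton_iff_inner_right.1 w.2

theorem inner_orthogonal_span_left (w : (Submodule.span ℂ {q})ᗮ) : inner ℂ (w : E) q = 0 :=
  Submodule.mem_orthogonal_singleton_iff_inner_left.1 w.2

theorem continuous_cayley : Continuous (cayley q) := by
  unfold cayley
  have h : Continuous fun X : (Submodule.span ℂ {q})ᗮ × ℝ => 2 / cayleyDenom X :=
    continuous_const.div continuous_cayleyDenom cayleyDenom_ne_zero
  fun_prop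

theorem inner_self_of_norm_eq_one (hq : ‖q‖ = 1) : inner ℂ q q = 1 := by
  rw [inner_self_eq_norm_sq_to_K, hq]
  simp

/-- Writing `κ` for the denominator, everything reduces to `κ - conj κ = 2i(1 + |w|²)`. -/
theorem norm_cayley (hq : ‖q‖ = 1) (X : (Submodule.span ℂ {q})ᗮ × ℝ) : ‖cayley q X‖ = 1 := by
  have hqq := inner_self_of_norm_eq_one hq
  have hk := cayleyDenom_ne_zero X
  have hk' : (starRingEnd ℂ) (cayleyDenom X) ≠ 0 := (map_ne_zero _).2 hk
  have hdiff : cayleyDenom X - (starRingEnd ℂ) (cayleyDenom X) =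
      2 * (1 + inner ℂ X.1 X.1) * Complex.I := by
    rw [conj_cayleyDenom, cayleyDenom]; ring
  have h : inner ℂ (cayley q X) (cayley q X) = 1 := by
    have hw : inner ℂ (X.1 : E) (X.1 : E) = inner ℂ X.1 X.1 := (Submodule.coe_inner _ _ _).symm
    simp only [cayley, inner_add_left, inner_add_right, inner_smul_left, inner_smul_right,
      inner_sub_left, inner_sub_right, hqq, inner_orthogonal_span_right,
      inner_orthogonal_span_left, hw, map_div₀, Complex.conj_I, map_ofNat]
    field_simp
    linear_combination (2 * Complex.I) * hdiff + 4 * inner ℂ X.1 X.1 * Complex.I_sq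
  rw [inner_self_eq_norm_sq_to_K] at h
  have h' : ‖cayley q X‖ ^ 2 = 1 := by
    have := congrArg Complex.re h
    simpa [← Complex.ofReal_pow] using this
  exact (pow_eq_one_iff_of_nonneg (norm_nonneg _) two_ne_zero).1 h'

theorem inner_cayley (hq : ‖q‖ = 1) (X : (Submodule.span ℂ {q})ᗮ × ℝ) :
    inner ℂ q (cayley q X) = 1 - 2 * Complex.I / cayleyDenom X := by
  simp only [cayley, inner_add_right, inner_smul_right, inner_sub_right,
    inner_self_of_norm_eq_one hq, inner_orthogonal_span_right]
  ring

/-- The inverse of the Cayley transform. -/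
noncomputable def cayleyInv (q : E) (p : E) : (Submodule.span ℂ {q})ᗮ × ℝ :=
  ((Complex.I / (1 - inner ℂ q p)) • (Submodule.span ℂ {q})ᗮ.orthogonalProjectionOnto p,
    -(Complex.I / (1 - inner ℂ q p)).re)

/-- The component along `q` determines the denominator, since `i / (1 - ⟪q, p⟫) = κ / 2`. Its real
part yields the height, and rescaling the orthogonal projection yields `w`. -/
theorem cayleyInv_cayley (hq : ‖q‖ = 1) (X : (Submodule.span ℂ {q})ᗮ × ℝ) :
    cayleyInv q (cayley q X) = X := by
  have hk := cayleyDenom_ne_zero X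
  have h : Complex.I / (1 - inner ℂ q (cayley q X)) = cayleyDenom X / 2 := by
    rw [inner_cayley hq]
    field_simp
    ring
  have hPq : (Submodule.span ℂ {q})ᗮ.orthogonalProjectionOnto q = 0 :=
    Submodule.orthogonalProjectionOnto_orthogonal_apply_eq_zero
      (Submodule.mem_span_singleton_self q)
  refine Prod.ext ?_ ?_
  · simp only [cayleyInv, h]
    rw [cayley, map_add, map_smul, map_sub, map_smul, hPq,
      Submodule.orthogonalProjectionOnto_mem_subspace_eq_self, smul_zero, sub_zero, zero_add,
      smul_smul, div_mul_div_cancel₀ (by norm_num), div_self hk, one_smul]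
  · simp only [cayleyInv, h]
    rw [show cayleyDenom X / 2 = ((1 / 2 : ℝ) : ℂ) * cayleyDenom X by push_cast; ring,
      Complex.re_ofReal_mul, cayleyDenom_re]
    ring

theorem cayley_cayleyInv (hq : ‖q‖ = 1) {p : E} (hp : ‖p‖ = 1) (hpq : p ≠ q) :
    cayley q (cayleyInv q p) = p := by
  set c := inner ℂ q p with hc
  have hc1 : 1 - c ≠ 0 := by
    rw [sub_ne_zero]
    intro h
    exact hpq ((inner_eq_one_iff_of_norm_eq_one hq hp).1 h.symm).symm
  set w := (Submodule.span ℂ {q})ᗮ.orthogonalProjectionOnto p with hw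
  have hdec : (w : E) = p - c • q := by
    have h1 := Submodule.starProjection_add_starProjection_orthogonal (K := Submodule.span ℂ {q}) p
    rw [Submodule.starProjection_unit_singleton ℂ hq] at h1
    exact eq_sub_of_add_eq' h1
  have hww : inner ℂ w w = 1 - (starRingEnd ℂ) c * c := by
    have hpc : inner ℂ p q = (starRingEnd ℂ) c := (inner_conj_symm p q).symm
    rw [Submodule.coe_inner, hdec]
    simp only [inner_sub_left, inner_sub_right, inner_smul_left, inner_smul_right,
      inner_self_of_norm_eq_one hq, inner_self_of_norm_eq_one hp, hpc, ← hc]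
    ring
  have hconj : 1 - (starRingEnd ℂ) c ≠ 0 := by
    have := (map_ne_zero (starRingEnd ℂ)).2 hc1
    simpa using this
  have hre : (((Complex.I / (1 - c)).re : ℝ) : ℂ) =
      (Complex.I / (1 - c) - Complex.I / (1 - (starRingEnd ℂ) c)) / 2 := by
    rw [Complex.re_eq_add_conj]
    simp only [map_div₀, Complex.conj_I, map_sub, map_one]
    ring
  have hden : cayleyDenom (cayleyInv q p) = 2 * (Complex.I / (1 - c)) := by
    simp only [cayleyDenom, cayleyInv, ← hc, ← hw, inner_smul_left, inner_smul_right, hww,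
      Complex.ofReal_neg, hre, map_div₀, map_sub, map_one, Complex.conj_I]
    field_simp
    linear_combination ((starRingEnd ℂ) c * c - 1) * Complex.I_sq
  rw [cayley, hden]
  simp only [cayleyInv, ← hc, ← hw, Submodule.coe_smul, hdec]
  have hI := Complex.I_ne_zero
  have e1 : 2 / (2 * (Complex.I / (1 - c))) * (Complex.I / (1 - c)) = 1 := by field_simp
  have e2 : 2 / (2 * (Complex.I / (1 - c))) * Complex.I = 1 - c := by field_simp
  rw [smul_sub, smul_smul, smul_smul, e1, e2]
  module

theorem continuousOn_cayleyInv (hq : ‖q‖ = 1) :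
    ContinuousOn (cayleyInv q) {p | ‖p‖ = 1 ∧ p ≠ q} := by
  have h : ContinuousOn (fun p => Complex.I / (1 - inner ℂ q p)) {p | ‖p‖ = 1 ∧ p ≠ q} := by
    refine continuousOn_const.div (by fun_prop) fun p hp => ?_
    rw [sub_ne_zero]
    intro h
    exact hp.2 ((inner_eq_one_iff_of_norm_eq_one hq hp.1).1 h.symm).symm
  exact (h.smul (by fun_prop)).prodMk (Complex.continuous_re.comp_continuousOn h).neg

/-- The Cayley transform of a horizontal curve. -/
theorem hasDerivAt_cayley {w : ℝ → (Submodule.span ℂ {q})ᗮ} {u : ℝ → ℝ}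
    {w' : (Submodule.span ℂ {q})ᗮ} {t : ℝ} (hw : HasDerivAt w w' t)
    (hu : HasDerivAt u (inner ℂ (w t) w').im t) :
    HasDerivAt (fun s => cayley q (w s, u s))
      ((2 / cayleyDenom (w t, u t)) • (w' : E) -
        (2 * (2 * Complex.I * inner ℂ (w t) w') / cayleyDenom (w t, u t) ^ 2) •
          ((w t : E) - Complex.I • q)) t := by
  have hk := cayleyDenom_ne_zero (w t, u t)
  have h1 : HasDerivAt (fun s => 2 / cayleyDenom (w s, u s))
      (-(2 * (2 * Complex.I * inner ℂ (w t) w') / cayleyDenom (w t, u t) ^ 2)) t := by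
    have := ((hasDerivAt_inv hk).comp t (hasDerivAt_cayleyDenom hw hu)).const_mul (2 : ℂ)
    refine (this.congr_deriv ?_).congr_of_eventuallyEq (Eventually.of_forall fun s => ?_)
    · field_simp
    · simp [div_eq_mul_inv]
  have h2 : HasDerivAt (fun s => (w s : E)) (w' : E) t :=
    ((Submodule.subtypeL (Submodule.span ℂ {q})ᗮ).restrictScalars ℝ).hasFDerivAt.comp_hasDerivAt t hw
  have h3 := (h1.smul (h2.sub_const (Complex.I • q))).const_add q
  refine h3.congr_deriv ?_
  rw [neg_smul, ← sub_eq_add_neg]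

/-- The vector is the velocity from `hasDerivAt_cayley`. Its orthogonality to the point, which is
complex tangency, again reduces to the formula for `κ - conj κ`. -/
theorem inner_cayley_deriv_eq_zero (hq : ‖q‖ = 1) (X : (Submodule.span ℂ {q})ᗮ × ℝ)
    (w' : (Submodule.span ℂ {q})ᗮ) :
    inner ℂ (cayley q X) ((2 / cayleyDenom X) • (w' : E) -
        (2 * (2 * Complex.I * inner ℂ X.1 w') / cayleyDenom X ^ 2) •
          ((X.1 : E) - Complex.I • q)) = 0 := by
  have hqq := inner_self_of_norm_eq_one hq
  have hk := cayleyDenom_ne_zero X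
  have hk' : (starRingEnd ℂ) (cayleyDenom X) ≠ 0 := (map_ne_zero _).2 hk
  have hdiff : cayleyDenom X - (starRingEnd ℂ) (cayleyDenom X) =
      2 * (1 + inner ℂ X.1 X.1) * Complex.I := by
    rw [conj_cayleyDenom, cayleyDenom]; ring
  have hw : inner ℂ (X.1 : E) (X.1 : E) = inner ℂ X.1 X.1 := (Submodule.coe_inner _ _ _).symm
  have hw' : inner ℂ (X.1 : E) (w' : E) = inner ℂ X.1 w' := (Submodule.coe_inner _ _ _).symm
  simp only [cayley, inner_add_left, inner_smul_left, inner_smul_right,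
    inner_sub_left, inner_sub_right, hqq, inner_orthogonal_span_right,
    inner_orthogonal_span_left, hw, hw', map_div₀, Complex.conj_I, map_ofNat]
  field_simp
  linear_combination 4 * inner ℂ X.1 w' * hdiff +
    (4 * inner ℂ X.1 w' * (starRingEnd ℂ) (cayleyDenom X) + 8 * inner ℂ X.1 w' * Complex.I) *
      Complex.I_sq

/-- Pairing with `q` isolates the coefficient of the second term. If the vector were zero, that
coefficient would vanish, and then so would `w'`. -/
theorem cayley_deriv_ne_zero (hq : ‖q‖ = 1) (X : (Submodule.span ℂ {q})ᗮ × ℝ)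
    {w' : (Submodule.span ℂ {q})ᗮ} (hw' : w' ≠ 0) :
    (2 / cayleyDenom X) • (w' : E) - (2 * (2 * Complex.I * inner ℂ X.1 w') / cayleyDenom X ^ 2) •
          ((X.1 : E) - Complex.I • q) ≠ 0 := by
  intro h
  have hk := cayleyDenom_ne_zero X
  have h1 := congrArg (fun y => inner ℂ q y) h
  simp only [inner_sub_right, inner_smul_right, inner_orthogonal_span_right,
    inner_self_of_norm_eq_one hq, inner_zero_right] at h1
  have h2 : 2 * (2 * Complex.I * inner ℂ X.1 w') / cayleyDenom X ^ 2 = 0 := by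
    have : 2 * (2 * Complex.I * inner ℂ X.1 w') / cayleyDenom X ^ 2 * Complex.I = 0 := by
      linear_combination h1
    exact (mul_eq_zero.1 this).resolve_right Complex.I_ne_zero
  rw [h2, zero_smul, sub_zero, smul_eq_zero] at h
  rcases h with h | h
  · exact div_ne_zero two_ne_zero hk h
  · exact hw' (Submodule.coe_eq_zero.1 h)

end Cayley

/-! ### Real-analyticity of the curves -/

section EntireCurveRegularity

open scoped ContDiff

variable {W : Type*} [NormedAddCommGroup W] [InnerProductSpace ℂ W]
  {P : W × ℝ} {V : ℂ → W}

theorem hasDerivAt_entireCurve_fst [CompleteSpace W] (hV : Differentiable ℂ V) (t : ℝ) :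
    HasDerivAt (fun s => (entireCurve P V s).1) (V t) t :=
  hasDerivAt_horizontalPos (P := P) hV.continuous_comp_ofReal t

theorem hasDerivAt_entireCurve_snd (hV : Differentiable ℂ V) (t : ℝ) :
    HasDerivAt (fun s => (entireCurve P V s).2) (inner ℂ (entireCurve P V t).1 (V t)).im t := by
  have hc := hV.continuous_comp_ofReal
  have hp := continuous_horizontalPos (P := P) hc.intervalIntegrableOnLine
  have hi : Continuous fun s : ℝ =>
      (inner ℂ (horizontalPos P (fun t : ℝ => V t) s) (V s)).im :=
    Complex.continuous_im.comp (hp.inner hc)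
  exact (intervalIntegral.integral_hasDerivAt_right (hi.intervalIntegrable _ _)
    (hi.stronglyMeasurableAtFilter _ _) hi.continuousAt).const_add _

theorem Differentiable.contDiff_comp_ofReal [CompleteSpace W] (hV : Differentiable ℂ V) :
    ContDiff ℝ ω fun t : ℝ => V t := by
  rw [contDiff_omega_iff_analyticOnNhd]
  intro t _
  exact ((hV.analyticAt (t : ℂ)).restrictScalars (𝕜 := ℝ)).comp (Complex.ofRealCLM.analyticAt t)

theorem ContDiff.omega_of_hasDerivAt {F : Type*} [NormedAddCommGroup F] [NormedSpace ℝ F]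
    [CompleteSpace F] {a g : ℝ → F} (ha : ContDiff ℝ ω a) (hg : ∀ t, HasDerivAt g (a t) t) :
    ContDiff ℝ ω g := by
  rw [contDiff_omega_iff_analyticOnNhd] at *
  exact fun t _ => (ha t trivial).of_hasDerivAt (Eventually.of_forall hg)

theorem contDiff_entireCurve_fst [CompleteSpace W] (hV : Differentiable ℂ V) :
    ContDiff ℝ ω fun s => (entireCurve P V s).1 :=
  hV.contDiff_comp_ofReal.omega_of_hasDerivAt (hasDerivAt_entireCurve_fst hV)

theorem contDiff_entireCurve_snd [CompleteSpace W] (hV : Differentiable ℂ V) :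
    ContDiff ℝ ω fun s => (entireCurve P V s).2 := by
  refine ContDiff.omega_of_hasDerivAt (Complex.imCLM.contDiff.comp ?_)
    (hasDerivAt_entireCurve_snd hV)
  exact (contDiff_entireCurve_fst hV).inner ℂ hV.contDiff_comp_ofReal

theorem contDiff_cayley_entireCurve {E : Type*} [NormedAddCommGroup E] [InnerProductSpace ℂ E]
    {q : E} [CompleteSpace (Submodule.span ℂ {q})ᗮ] {P : (Submodule.span ℂ {q})ᗮ × ℝ}
    {V : ℂ → (Submodule.span ℂ {q})ᗮ} (hV : Differentiable ℂ V) :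
    ContDiff ℝ ω fun t => cayley q (entireCurve P V t) := by
  have h1 := contDiff_entireCurve_fst (P := P) hV
  have h2 := contDiff_entireCurve_snd (P := P) hV
  have h3 : ContDiff ℝ ω fun t => cayleyDenom (entireCurve P V t) := by
    have h4 : ContDiff ℝ ω fun t => inner ℂ (entireCurve P V t).1 (entireCurve P V t).1 :=
      h1.inner ℂ h1
    have h5 : ContDiff ℝ ω fun t => ((entireCurve P V t).2 : ℂ) :=
      Complex.ofRealCLM.contDiff.comp h2
    exact ((contDiff_const.mul h5).neg).add ((contDiff_const.add h4).mul contDiff_const)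
  have h4 : ContDiff ℝ ω fun t => 2 / cayleyDenom (entireCurve P V t) := by
    simp only [div_eq_mul_inv]
    exact contDiff_const.mul (h3.inv fun t => cayleyDenom_ne_zero _)
  have h5 : ContDiff ℝ ω fun t => ((entireCurve P V t).1 : E) :=
    ((Submodule.subtypeL (Submodule.span ℂ {q})ᗮ).restrictScalars ℝ).contDiff.comp h1
  exact contDiff_const.add (h4.smul (h5.sub contDiff_const))

end EntireCurveRegularity

/-! ### Transfer to the sphere -/

section Sphere

variable {n : ℕ}

theorem isConnected_univ_CSphere (hn : 1 < n) : IsConnected (univ : Set (CSphere n)) := by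
  have hrank : 1 < Module.rank ℝ (CSpace n) := by
    rw [← Module.finrank_eq_rank, finrank_real_of_complex, finrank_euclideanSpace_fin]
    exact_mod_cast (by omega : 1 < 2 * n)
  exact connectedSpace_iff_univ.1
    (isConnected_iff_connectedSpace.1 (isConnected_sphere hrank (0 : CSpace n) zero_le_one))

/-- The Cayley transform as a map to the unit sphere of `ℂⁿ`. -/
noncomputable def sphereCayley (q : CSphere n)
    (X : (Submodule.span ℂ {(q : CSpace n)})ᗮ × ℝ) : CSphere n :=
  ⟨cayley (q : CSpace n) X, mem_sphere_zero_iff_norm.2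
    (norm_cayley (mem_sphere_zero_iff_norm.1 q.2) X)⟩

theorem continuous_sphereCayley (q : CSphere n) : Continuous (sphereCayley q) :=
  continuous_cayley.subtype_mk _

theorem sphereCayley_injective (q : CSphere n) : Function.Injective (sphereCayley q) := by
  intro X Y h
  have h' := congrArg (fun p : CSphere n => cayleyInv (q : CSpace n) p) h
  simpa only [sphereCayley, cayleyInv_cayley (mem_sphere_zero_iff_norm.1 q.2)] using h'

theorem sphereCayley_cayleyInv {q p : CSphere n} (h : p ≠ q) :
    sphereCayley q (cayleyInv (q : CSpace n) p) = p :=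
  Subtype.ext (cayley_cayleyInv (mem_sphere_zero_iff_norm.1 q.2) (mem_sphere_zero_iff_norm.1 p.2)
    fun h' => h (Subtype.ext h'))

/-- As `q` lies outside `ω`, the preimage is the image of `ω` under the inverse transform, which is
continuous away from `q`. -/
theorem isPreconnected_preimage_sphereCayley {q : CSphere n} {ω : Set (CSphere n)}
    (hω : IsPreconnected ω) (hq : q ∉ ω) : IsPreconnected (sphereCayley q ⁻¹' ω) := by
  have h1 : sphereCayley q ⁻¹' ω = (fun p : CSphere n => cayleyInv (q : CSpace n) p) '' ω := by
    ext X
    constructor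
    · intro hX
      exact ⟨_, hX, cayleyInv_cayley (mem_sphere_zero_iff_norm.1 q.2) X⟩
    · rintro ⟨p, hp, rfl⟩
      have hpq : p ≠ q := fun h => hq (h ▸ hp)
      change sphereCayley q _ ∈ ω
      rwa [sphereCayley_cayleyInv hpq]
  rw [h1]
  refine hω.image _ ?_
  refine (continuousOn_cayleyInv (mem_sphere_zero_iff_norm.1 q.2)).comp
    continuous_subtype_val.continuousOn fun p hp => ?_
  exact ⟨mem_sphere_zero_iff_norm.1 p.2, fun h => hq (Subtype.ext h ▸ hp)⟩

theorem isClosed_clusterSet (l : Filter ℝ) (f : ℝ → CSphere n) : IsClosed (clusterSet l f) :=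
  isClosed_setOfPred_clusterPt

/-- Cluster sets are closed, so clustering at the points other than `q`, the ones seen by the chart,
is enough. -/
theorem clusterSet_eq_closure {l : Filter ℝ} {f : ℝ → CSphere n} {ω : Set (CSphere n)}
    {q : CSphere n} (hf : ∀ t, f t ∈ ω) (hω : ω ⊆ closure (ω \ {q}))
    (h : ∀ p ∈ ω \ {q}, MapClusterPt p l f) : clusterSet l f = closure ω := by
  apply Subset.antisymm
  · intro p hp
    exact isClosed_closure.mem_of_mapClusterPt hp
      (Eventually.of_forall fun t => subset_closure (hf t))
  · have h1 : closure (ω \ {q}) ⊆ clusterSet l f :=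
      closure_minimal h (isClosed_clusterSet l f)
    exact closure_minimal (hω.trans h1) (isClosed_clusterSet l f)

theorem exists_isInjectiveLegendrianCurve (hn : 1 < n) {ω : Set (CSphere n)} {q : CSphere n}
    (hne : ω.Nonempty) (hopen : IsOpen ω) (hconn : IsPreconnected (sphereCayley q ⁻¹' ω))
    (hω : ω ⊆ closure (ω \ {q})) :
    ∃ f : ℝ → CSphere n, IsInjectiveLegendrianCurve f ∧ (∀ t : ℝ, f t ∈ ω) ∧
      clusterSet atTop f = closure ω ∧ clusterSet atBot f = closure ω := by
  have hq : ‖(q : CSpace n)‖ = 1 := mem_sphere_zero_iff_norm.1 q.2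
  obtain ⟨p₀, hp₀, hp₀q⟩ : (ω \ {q}).Nonempty := closure_nonempty_iff.1 (hne.mono hω)
  have : Fact (Module.finrank ℂ (CSpace n) = (n - 1) + 1) :=
    ⟨by rw [finrank_euclideanSpace_fin]; omega⟩
  have hq0 : (q : CSpace n) ≠ 0 := by
    rw [← norm_ne_zero_iff, hq]; exact one_ne_zero
  have hfin : Module.finrank ℂ (Submodule.span ℂ {(q : CSpace n)})ᗮ = n - 1 :=
    Submodule.finrank_orthogonal_span_singleton hq0
  -- The assumption `1 < n` enters here: the complement of `q` has positive dimension, so a unit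
  -- direction `e` exists.
  have hnt : Nontrivial (Submodule.span ℂ {(q : CSpace n)})ᗮ :=
    Module.nontrivial_of_finrank_pos (R := ℂ) (by omega)
  obtain ⟨e, he⟩ := exists_norm_eq (Submodule.span ℂ {(q : CSpace n)})ᗮ zero_le_one
  have hmem : cayleyInv (q : CSpace n) p₀ ∈ sphereCayley q ⁻¹' ω := by
    change sphereCayley q _ ∈ ω
    rwa [sphereCayley_cayleyInv hp₀q]
  have hproper : ProperSpace (Submodule.span ℂ {(q : CSpace n)})ᗮ :=
    FiniteDimensional.proper ℂ _
  obtain ⟨V, hV, hin, hinj, hVne, hclus⟩ := exists_entireCurve_clusterPt he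
    (hopen.preimage (continuous_sphereCayley q)) hconn hmem
  set γ := entireCurve (cayleyInv (q : CSpace n) p₀) V with hγ
  have hder : ∀ t, HasDerivAt (fun s => ((sphereCayley q (γ s) : CSphere n) : CSpace n)) _ t :=
    fun t => hasDerivAt_cayley (hasDerivAt_entireCurve_fst hV t) (hasDerivAt_entireCurve_snd hV t)
  have hmap : ∀ l : Filter ℝ, (∀ X ∈ sphereCayley q ⁻¹' ω, MapClusterPt X l γ) →
      ∀ p ∈ ω \ {q}, MapClusterPt p l fun t => sphereCayley q (γ t) := by
    intro l hl p hp
    have h1 := hl (cayleyInv (q : CSpace n) p) (by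
      change sphereCayley q _ ∈ ω
      rw [sphereCayley_cayleyInv hp.2]
      exact hp.1)
    have h2 := h1.continuousAt_comp (continuous_sphereCayley q).continuousAt
    rwa [sphereCayley_cayleyInv hp.2] at h2
  refine ⟨fun t => sphereCayley q (γ t), ⟨?_, ?_, fun t => ?_, fun t => ?_⟩, hin, ?_, ?_⟩
  · rw [← contDiff_omega_iff_analyticOnNhd]
    exact contDiff_cayley_entireCurve hV
  · exact (sphereCayley_injective q).comp hinj
  · rw [velocity, (hder t).deriv]
    exact cayley_deriv_ne_zero hq (γ t) (hVne t)
  · rw [mem_complexTangentSpace_iff, velocity, (hder t).deriv]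
    exact inner_cayley_deriv_eq_zero hq (γ t) (V t)
  · exact clusterSet_eq_closure hin hω (hmap _ fun X hX => (hclus X hX).1)
  · exact clusterSet_eq_closure hin hω (hmap _ fun X hX => (hclus X hX).2)

/-- If `ω` is not the whole sphere, `q` is taken outside it. If it is, any `q` serves, because the
preimage is all of `W × ℝ`. Either way, connectedness of `ω` minus an interior point is never
needed. -/
theorem exists_isInjectiveLegendrianCurve_of_isConnected (hn : 1 < n) {ω : Set (CSphere n)}
    (hopen : IsOpen ω) (hconn : IsConnected ω) :
    ∃ f : ℝ → CSphere n, IsInjectiveLegendrianCurve f ∧ (∀ t : ℝ, f t ∈ ω) ∧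
      clusterSet atTop f = closure ω ∧ clusterSet atBot f = closure ω := by
  by_cases h : ω = univ
  · subst h
    obtain ⟨q, -⟩ := hconn.nonempty
    have : ConnectedSpace (CSphere n) := connectedSpace_iff_univ.2 hconn
    -- A connected sphere with more than one point has no isolated points, so removing `q` leaves a
    -- dense set.
    have : Nontrivial (CSphere n) := by
      refine ⟨q, ⟨-q, by simp⟩, fun h => ?_⟩
      have h1 := congrArg (fun p : CSphere n => (p : CSpace n)) h
      have h2 : (q : CSpace n) = 0 := by
        have h4 : (2 : ℂ) • (q : CSpace n) = 0 := by
          rw [two_smul]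
          exact eq_neg_iff_add_eq_zero.1 h1
        exact (smul_eq_zero.1 h4).resolve_left two_ne_zero
      have h3 := mem_sphere_zero_iff_norm.1 q.2
      rw [h2, norm_zero] at h3
      exact zero_ne_one h3
    refine exists_isInjectiveLegendrianCurve hn (q := q) hconn.nonempty isOpen_univ ?_ ?_
    · exact isPreconnected_univ
    · rw [(dense_univ.sdiff_singleton q).closure_eq]
  · obtain ⟨q, hq⟩ := (ne_univ_iff_exists_notMem ω).1 h
    refine exists_isInjectiveLegendrianCurve hn (q := q) hconn.nonempty hopen
      (isPreconnected_preimage_sphereCayley hconn.isPreconnected hq) ?_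
    rw [sdiff_singleton_eq_self hq]
    exact subset_closure

end Sphere

theorem corollary1p4 (n : ℕ) (hn : 1 < n) :
    (∀ ω : Set (CSphere n), ω.Nonempty → IsOpen ω → IsConnected ω →
      ∃ f : ℝ → CSphere n, IsInjectiveLegendrianCurve f ∧ (∀ t : ℝ, f t ∈ ω) ∧
        clusterSet atTop f = closure ω ∧ clusterSet atBot f = closure ω) ∧
    (∃ f : ℝ → CSphere n, IsInjectiveLegendrianCurve f ∧ DenseRange f ∧
      clusterSet atTop f = Set.univ ∧ clusterSet atBot f = Set.univ) := by
  refine ⟨fun ω _ hopen hconn =>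
    exists_isInjectiveLegendrianCurve_of_isConnected hn hopen hconn, ?_⟩
  obtain ⟨f, hf, -, h1, h2⟩ :=
    exists_isInjectiveLegendrianCurve_of_isConnected hn isOpen_univ (isConnected_univ_CSphere hn)
  rw [closure_univ] at h1 h2
  refine ⟨f, hf, fun p => ?_, h1, h2⟩
  have hp : p ∈ clusterSet atTop f := h1 ▸ mem_univ p
  exact isClosed_closure.mem_of_mapClusterPt hp
    (Eventually.of_forall fun t => subset_closure (mem_range_self t))
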